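/- **Conventions.** All rings are commutative with unit. For a ring extension $R\subseteq S$, $[R,S]$ denotes the poset of $R$-subalgebras of $S$. The extension has FCP if every chain in $[R,S]$ is finite. An FCP extension $R\subseteq S$ is catenarian if all maximal chains of $[R,S]$ have the same length. The extension $R\subseteq S$ is t-closed if $b\in S$, $r\in R$, $b^2-rb\in R$, $b^3-rb^2\in R$ imply $b\in R$; the t-closure ${}_S^tR$ is the smallest $B\in[R,S]$ such that $B\subseteq S$ is t-closed. For an $R$-module $E$, $\mathrm{MSupp}_R(E)$ is the set of maximal ideals $P$ of $R$ with $E_P\neq 0$; the quotients ${}_S^tR/R$, $S/{}_S^tR$ and $S/R$ are taken as $R$-modules. For an extension $U\subseteq T$, $(U:T)=\{x\in U\mid xT\subseteq U\}$ is its conductor. An extension $U\subset T$ is minimal if $U\neq T$ and $[U,T]=\{U,T\}$; it is minimal inert if moreover $M:=(U:T)$ is a maximal ideal of both $U$ and $T$ and $U/M\to T/M$ is a minimal field extension. A minimal extension that is not inert is called minimal non-inert. **Proposition 3.6.** Let $R\subseteq S$ be an integral FCP extension such that ${}_S^tR\subseteq S$ is catenarian. Set $$\mathcal M_1:=\{N\in\mathrm{Max}(S)\mid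 N\cap R\in\mathrm{MSupp}_R({}_S^tR/R)\},\qquad \mathcal M_2:=\{N\in\mathrm{Max}(S)\mid N\cap R\in\mathrm{MSupp}_R(S/{}_S^tR)\}.$$ Then: 1. $\mathcal M_1\cup\mathcal M_2=\{N\in\mathrm{Max}(S)\mid N\cap R\in\mathrm{MSupp}_R(S/R)\}$. 2. $R\subseteq S$ is catenarian if and only if, for all $U,T,V\in[R,S]$ such that $U\subset T$ is minimal inert and $T\subset V$ is minimal non-inert, and for all $N\in\mathcal M_1$, $N'\in\mathcal M_2$ such that $(U:T)=N'\cap T$ and $(T:V)=N\cap T$, we have $N\neq N'$. 3. If $\mathcal M_1\cap\mathcal M_2=\emptyset$, then $R\subseteq S$ is catenarian. -/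

import Mathlib

/-! A ring extension `R ⊆ S` of commutative rings is an `R`-algebra `S` with injective structure
map; the poset `[R, S]` of intermediate rings is the lattice `Subalgebra R S`, in which `R` is `⊥`
and `S` is `⊤`. -/

namespace RingExt

section Extension

variable (R S : Type*) [CommRing R] [CommRing S] [Algebra R S]

/-- The extension `R ⊆ S` has FCP: each chain in `[R, S]` is finite. -/
def HasFCP : Prop :=
  ∀ c : Set (Subalgebra R S), IsChain (· ≤ ·) c → c.Finite

/-- The extension `R ⊆ S` is catenarian: all maximal chains of `[R, S]` have the same length.
A chain of length `n` has `n + 1` members, so that equal lengths mean equal numbers of members. -/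
def IsCatenarian : Prop :=
  ∀ c c' : Set (Subalgebra R S),
    IsMaxChain (· ≤ ·) c → IsMaxChain (· ≤ ·) c' → c.encard = c'.encard

/-- The extension `R ⊆ S` is t-closed: if `b ∈ S` and `r ∈ R` satisfy `b ^ 2 - r b ∈ R` and
`b ^ 3 - r b ^ 2 ∈ R`, then `b ∈ R`. -/
def IsTClosed : Prop :=
  ∀ (b : S) (r : R),
    b ^ 2 - algebraMap R S r * b ∈ Set.range (algebraMap R S) →
    b ^ 3 - algebraMap R S r * b ^ 2 ∈ Set.range (algebraMap R S) →
    b ∈ Set.range (algebraMap R S)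

/-- The t-closure of `R` in `S`: the smallest `B ∈ [R, S]` such that `B ⊆ S` is t-closed
(see `tClosure_isLeast`). -/
def tClosure : Subalgebra R S :=
  sInf {B : Subalgebra R S | IsTClosed B S}

theorem tClosure_isLeast :
    IsLeast {B : Subalgebra R S | IsTClosed B S} (tClosure R S) := by
  refine ⟨?_, fun B hB => sInf_le hB⟩
  have key : ∀ (B : Subalgebra R S) (x : S), x ∈ Set.range (algebraMap B S) ↔ x ∈ B :=
    fun B x => ⟨by rintro ⟨y, rfl⟩; exact y.2, fun h => ⟨⟨x, h⟩, rfl⟩⟩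
  intro b r h2 h3
  rw [key] at h2 h3 ⊢
  refine Algebra.mem_sInf.2 fun B hB => ?_
  have hle : tClosure R S ≤ B := sInf_le hB
  exact (key B b).1 (hB b ⟨(r : S), hle r.2⟩ ((key B _).2 (hle h2)) ((key B _).2 (hle h3)))

/-- `MSupp_R(E)`: the maximal ideals of `R` that belong to the support of the `R`-module `E`. -/
def MSupp (E : Type*) [AddCommGroup E] [Module R E] : Set (Ideal R) :=
  {P | P.IsMaximal ∧ P ∈ PrimeSpectrum.asIdeal '' Module.support R E}

/-- The maximal ideals `N` of `S` such that `N ∩ R` belongs to `MSupp_R(E)`. -/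
def maxOverMSupp (E : Type*) [AddCommGroup E] [Module R E] : Set (Ideal S) :=
  {N | N.IsMaximal ∧ N.comap (algebraMap R S) ∈ MSupp R E}

/-- `{N ∈ Max(S) | N ∩ R ∈ MSupp(B/R)}`, where `B` is the t-closure of `R` in `S`. -/
def M₁ : Set (Ideal S) :=
  maxOverMSupp R S
    (tClosure R S ⧸ Subalgebra.toSubmodule (⊥ : Subalgebra R (tClosure R S)))

/-- `{N ∈ Max(S) | N ∩ R ∈ MSupp(S/B)}`, where `B` is the t-closure of `R` in `S`. -/
def M₂ : Set (Ideal S) :=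
  maxOverMSupp R S (S ⧸ Subalgebra.toSubmodule (tClosure R S))

end Extension

section Subextension

variable {R S : Type*} [CommRing R] [CommRing S] [Algebra R S]

/-- The conductor `(U : T)` of `U ⊆ T`, as a subset of `S`: the `x` with `x T ⊆ U`. As `1 ∈ T`,
such an `x` lies in `U`. -/
def conductorSet (U T : Subalgebra R S) : Set S :=
  {x | ∀ t ∈ T, x * t ∈ U}

/-- The conductor `(U : T)` of `U ⊆ T`, as an ideal of `T`. -/
def conductor (U T : Subalgebra R S) : Ideal T where
  carrier := {x | (x : S) ∈ conductorSet U T}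
  zero_mem' := fun t _ => by simp
  add_mem' := fun {a b} ha hb t ht => by
    simpa [add_mul] using U.add_mem (ha t ht) (hb t ht)
  smul_mem' := fun c x hx t ht => by
    have h := hx (c * t) (T.mul_mem c.2 ht)
    have e : ((c • x : T) : S) * t = (x : S) * (c * t) := by
      simp only [smul_eq_mul, MulMemClass.coe_mul]; ring
    rw [e]; exact h

/-- The injective ring morphism `U / (U : T) → T / (U : T)` induced by the inclusion `U ⊆ T`. -/
def residualMap {U T : Subalgebra R S} (h : U ≤ T) :
    U ⧸ (conductor U T).comap (Subalgebra.inclusion h).toRingHom →+* T ⧸ conductor U T :=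
  Ideal.quotientMap (conductor U T) (Subalgebra.inclusion h).toRingHom le_rfl

/-- The extension `U ⊂ T` is minimal: `U ≠ T` and there is no ring strictly between. -/
def IsMinimal (U T : Subalgebra R S) : Prop :=
  U < T ∧ Set.Icc U T = {U, T}

/-- The extension `U ⊂ T` is inert: its conductor `M` is a maximal ideal of `U` and of `T`, and the
field extension `U / M → T / M` is minimal, that is, `U / M` is a proper subring of `T / M` and
there is no ring strictly between. -/
def IsInert (U T : Subalgebra R S) : Prop :=
  ∃ h : U ≤ T,
    ((conductor U T).comap (Subalgebra.inclusion h).toRingHom).IsMaximal ∧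
    (conductor U T).IsMaximal ∧
    IsCoatom (residualMap h).range

end Subextension

end RingExt

/-! Write `B` for the t-closure. Everything turns on a minimal inert step `U ⊂ T` followed by a
minimal non-inert step `T ⊂ V`, and on whether their conductors agree.

If they agree, say both are `C`, then `V = T + T x` with `x ^ 2 - r x ∈ C` and `r ∈ U`. Then `U ⊂ U
+ U x ⊂ U + T x ⊂ V` has three strict steps and avoids `T`, so `R ⊆ S` is not catenarian
(`exists_longer_chain`, `exists_encard_ne_of_longer_chain`).

If they differ, they are comaximal in `T`, and the two steps can be exchanged (`exists_exchange`).
When this holds everywhere, every maximal chain can be sorted, keeping its length, into non-inert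
steps followed by inert ones. Non-inert steps cannot leave `B` and inert steps preserve t-closedness
downwards, so the sorted chain changes type exactly at `B`. The inert part has a fixed length
because `B ⊆ S` is catenarian. Non-inert steps do not change residue fields, so each adds one to the
`R`-length of the quotient by `R`, and their number is the length of `B / R` (`StepPath.length_eq`).

The sets `M₁` and `M₂` enter by locating conductors: a maximal ideal of `S` over the conductor of an
inert step lies in `M₂`, and one that cuts out the conductor of a non-inert step lies in `M₁`. Equal
conductors thus give one ideal in both. -/

namespace RingExt

/-! ### Conductors and the structure of minimal integral extensions -/

section Conductor

variable {R S : Type*} [CommRing R] [CommRing S] [Algebra R S]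

theorem isMinimal_iff_covBy {U T : Subalgebra R S} : IsMinimal U T ↔ U ⋖ T := by
  constructor
  · rintro ⟨h, h2⟩
    refine ⟨h, fun W h3 h4 => ?_⟩
    have : W ∈ ({U, T} : Set (Subalgebra R S)) := h2 ▸ ⟨h3.le, h4.le⟩
    rcases this with rfl | rfl
    · exact lt_irrefl _ h3
    · exact lt_irrefl _ h4
  · intro h
    exact ⟨h.lt, h.Icc_eq⟩

/-- The subring `U + J`, for an additive subgroup `J` stable under products with `U` and `J`. -/
def addSubgroupSup (U : Subalgebra R S) (J : AddSubgroup S) (hU : ∀ u ∈ U, ∀ j ∈ J, u * j ∈ J)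
    (hJ : ∀ i ∈ J, ∀ j ∈ J, i * j ∈ J) : Subalgebra R S where
  carrier := {s | ∃ u ∈ U, ∃ j ∈ J, u + j = s}
  mul_mem' := by
    rintro _ _ ⟨u, hu, j, hj, rfl⟩ ⟨v, hv, i, hi, rfl⟩
    exact ⟨u * v, U.mul_mem hu hv, u * i + v * j + j * i,
      J.add_mem (J.add_mem (hU u hu i hi) (hU v hv j hj)) (hJ j hj i hi), by ring⟩
  add_mem' := by
    rintro _ _ ⟨u, hu, j, hj, rfl⟩ ⟨v, hv, i, hi, rfl⟩
    exact ⟨u + v, U.add_mem hu hv, j + i, J.add_mem hj hi, by ring⟩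
  algebraMap_mem' := fun r => ⟨_, U.algebraMap_mem r, 0, J.zero_mem, by simp⟩

section
variable {U : Subalgebra R S} {J : AddSubgroup S} {hU : ∀ u ∈ U, ∀ j ∈ J, u * j ∈ J}
  {hJ : ∀ i ∈ J, ∀ j ∈ J, i * j ∈ J}

theorem mem_addSubgroupSup {s : S} :
    s ∈ addSubgroupSup U J hU hJ ↔ ∃ u ∈ U, ∃ j ∈ J, u + j = s := Iff.rfl

theorem le_addSubgroupSup : U ≤ addSubgroupSup U J hU hJ :=
  fun u hu => ⟨u, hu, 0, J.zero_mem, add_zero u⟩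

theorem mem_addSubgroupSup_of_mem {j : S} (hj : j ∈ J) : j ∈ addSubgroupSup U J hU hJ :=
  ⟨0, U.zero_mem, j, hj, zero_add j⟩

theorem addSubgroupSup_le {T : Subalgebra R S} (h : U ≤ T) (h2 : ∀ j ∈ J, j ∈ T) :
    addSubgroupSup U J hU hJ ≤ T := by
  rintro _ ⟨u, hu, j, hj, rfl⟩
  exact T.add_mem (h hu) (h2 j hj)

end

/-- The conductor `(U : T)` as an additive subgroup of `S`. -/
def conductorAddSubgroup (U T : Subalgebra R S) : AddSubgroup S where
  carrier := conductorSet U T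
  zero_mem' := fun t _ => by simp
  add_mem' := fun {a b} ha hb t ht => by
    simpa [add_mul] using U.add_mem (ha t ht) (hb t ht)
  neg_mem' := fun {a} ha t ht => by
    simpa using U.neg_mem (ha t ht)

variable {U T V : Subalgebra R S}

theorem mem_of_mem_conductor {x : S} (hx : x ∈ conductorAddSubgroup U T) : x ∈ U := by
  simpa using hx 1 T.one_mem

theorem conductor_mul_mem {x t : S} (hx : x ∈ conductorAddSubgroup U T) (ht : t ∈ T) :
    x * t ∈ conductorAddSubgroup U T := fun s hs => by
  rw [mul_assoc]; exact hx _ (T.mul_mem ht hs)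

theorem mul_conductor_mem {x t : S} (ht : t ∈ T) (hx : x ∈ conductorAddSubgroup U T) :
    t * x ∈ conductorAddSubgroup U T := mul_comm x t ▸ conductor_mul_mem hx ht

theorem one_notMem_conductor (h : U < T) : (1 : S) ∉ conductorAddSubgroup U T := fun h1 =>
  h.not_ge fun t ht => by simpa using h1 t ht

theorem isMaximal_iff_exists_mul_sub_one {A : Type*} [CommRing A] {I : Ideal A} :
    I.IsMaximal ↔ (1 : A) ∉ I ∧ ∀ x ∉ I, ∃ y, x * y - 1 ∈ I := by
  rw [Ideal.isMaximal_iff]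
  refine and_congr_right fun h1 => ⟨fun h x hx => ?_, fun h J x hIJ hx hxJ => ?_⟩
  · have h2 := h (I ⊔ Ideal.span {x}) x le_sup_left hx
      (Ideal.mem_sup_right (Ideal.mem_span_singleton_self x))
    obtain ⟨i, hi, j, hj, e⟩ := Submodule.mem_sup.1 h2
    obtain ⟨y, rfl⟩ := Ideal.mem_span_singleton.1 hj
    exact ⟨y, by rw [← e]; simpa using hi⟩
  · obtain ⟨y, hy⟩ := h x hx
    have := J.sub_mem (J.mul_mem_right y hxJ) (hIJ hy)
    simpa using this

theorem conductor_isMaximal_iff (h : U < T) :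
    (conductor U T).IsMaximal ↔ ∀ x ∈ T, x ∉ conductorAddSubgroup U T →
      ∃ y ∈ T, x * y - 1 ∈ conductorAddSubgroup U T := by
  rw [isMaximal_iff_exists_mul_sub_one]
  constructor
  · rintro ⟨-, h2⟩ x hx hxC
    obtain ⟨y, hy⟩ := h2 ⟨x, hx⟩ hxC
    exact ⟨y, y.2, hy⟩
  · intro h2
    refine ⟨one_notMem_conductor h, fun x hx => ?_⟩
    obtain ⟨y, hy, h3⟩ := h2 x x.2 hx
    exact ⟨⟨y, hy⟩, h3⟩

/-- In a minimal extension `U ⊂ T`, each ideal of `T` outside the conductor supplements `U`. -/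
theorem exists_add_eq_of_covBy (h : U ⋖ T) (J : AddSubgroup S) (hJT : ∀ j ∈ J, j ∈ T)
    (hT : ∀ t ∈ T, ∀ j ∈ J, t * j ∈ J) {y : S} (hy : y ∈ J)
    (hyC : y ∉ conductorAddSubgroup U T) {t : S} (ht : t ∈ T) :
    ∃ u ∈ U, ∃ j ∈ J, u + j = t := by
  let W := addSubgroupSup U J (fun u hu => hT u (h.le hu)) (fun i hi => hT i (hJT i hi))
  rcases h.eq_or_eq (c := W) le_addSubgroupSup (addSubgroupSup_le h.le hJT) with e | e
  · refine absurd (fun s hs => ?_) hyC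
    have : s * y ∈ W := mem_addSubgroupSup_of_mem (hT s hs y hy)
    rwa [e, mul_comm] at this
  · have : t ∈ W := e ▸ ht
    exact this

theorem exists_add_mul_eq_of_covBy (h : U ⋖ T) {y : S} (hy : y ∈ T)
    (hyC : y ∉ conductorAddSubgroup U T) {t : S} (ht : t ∈ T) :
    ∃ u ∈ U, ∃ s ∈ T, u + y * s = t := by
  let J : AddSubgroup S := T.toSubring.toAddSubgroup.map (AddMonoidHom.mulLeft y)
  have hJ : ∀ j, j ∈ J ↔ ∃ s ∈ T, y * s = j := fun j => Iff.rfl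
  obtain ⟨u, hu, j, hj, e⟩ := exists_add_eq_of_covBy h J
    (fun j hj => by
      obtain ⟨s, hs, rfl⟩ := (hJ j).1 hj
      exact T.mul_mem hy hs)
    (fun t ht j hj => by
      obtain ⟨s, hs, rfl⟩ := (hJ j).1 hj
      exact (hJ _).2 ⟨t * s, T.mul_mem ht hs, by ring⟩)
    ((hJ y).2 ⟨1, T.one_mem, mul_one y⟩) hyC ht
  obtain ⟨s, hs, rfl⟩ := (hJ j).1 hj
  exact ⟨u, hu, s, hs, e⟩

/-- The conductor of a minimal integral extension `U ⊂ T` is a maximal ideal of `U`. -/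
theorem exists_mul_sub_one_mem_conductor [Algebra.IsIntegral R S] (h : U ⋖ T) {u : S}
    (hu : u ∈ U) (huC : u ∉ conductorAddSubgroup U T) :
    ∃ v ∈ U, u * v - 1 ∈ conductorAddSubgroup U T := by
  obtain ⟨x, hxT, hxU⟩ := Set.exists_of_ssubset h.lt
  let A : Subalgebra U S := Algebra.adjoin U {x}
  have hUA : ∀ w ∈ U, w ∈ A := fun w hw => A.algebraMap_mem ⟨w, hw⟩
  have hAT : A.restrictScalars R = T := by
    have hle : A.restrictScalars R ≤ T := by
      intro s hs
      refine Algebra.adjoin_induction (p := fun y _ => y ∈ T) ?_ ?_ ?_ ?_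
        (show s ∈ Algebra.adjoin U {x} from hs)
      · rintro y rfl; exact hxT
      · intro r; exact h.le r.2
      · intro a b _ _ ha hb; exact T.add_mem ha hb
      · intro a b _ _ ha hb; exact T.mul_mem ha hb
    refine (h.eq_or_eq (c := A.restrictScalars R) hUA hle).resolve_left fun e => hxU ?_
    have hxA : x ∈ Algebra.adjoin U {x} := Algebra.self_mem_adjoin_singleton U x
    exact e ▸ (show x ∈ A.restrictScalars R from hxA)
  have hx : IsIntegral U x := (Algebra.IsIntegral.isIntegral (R := R) x).tower_top
  have hA : ∀ s, s ∈ A ↔ s ∈ T := fun s => by rw [← hAT]; rfl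
  have hfg : (Subalgebra.toSubmodule A).FG :=
    IsIntegral.fg_adjoin_singleton hx
  -- Nakayama: `T = U + u T` is finite over `U`, so some `r ∈ 1 + u U` multiplies `T` into `U`.
  obtain ⟨r, hr, hrA⟩ := Submodule.exists_sub_one_mem_and_smul_le_of_fg_of_le_sup
    (I := Ideal.span {(⟨u, hu⟩ : U)})
    (N := Subalgebra.toSubmodule (⊥ : Subalgebra U S)) hfg le_rfl (by
      intro t ht
      obtain ⟨w, hw, s, hs, rfl⟩ := exists_add_mul_eq_of_covBy h (h.le hu) huC ((hA t).1 ht)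
      refine Submodule.add_mem_sup ?_ ?_
      · exact (⊥ : Subalgebra U S).algebraMap_mem ⟨w, hw⟩
      · exact Submodule.smul_mem_smul (r := (⟨u, hu⟩ : U))
          (Ideal.mem_span_singleton_self _) ((hA s).2 hs))
  obtain ⟨v, hv⟩ := Ideal.mem_span_singleton.1 hr
  have hr' : (r : S) = 1 + u * v := by
    have := congrArg (Subtype.val) hv
    simp only [Subalgebra.coe_sub, Subalgebra.coe_one, Subalgebra.coe_mul] at this
    rw [← this]; ring
  have hrC : (r : S) ∈ conductorAddSubgroup U T := by
    intro t ht
    have h1 := hrA (Submodule.smul_mem_pointwise_smul _ r _ ((hA t).2 ht))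
    obtain ⟨w, hw⟩ := Algebra.mem_bot.1 h1
    have h2 : (r : S) * t = w := hw.symm
    rw [h2]; exact w.2
  refine ⟨-v, U.neg_mem v.2, ?_⟩
  have := (conductorAddSubgroup U T).neg_mem hrC
  rw [hr'] at this
  convert this using 1; ring

/-- Of the conditions defining inertness, only maximality of the conductor in `T` has content:
integrality gives maximality in `U`, and rings between the residue fields lift to rings between `U`
and `T`. -/
theorem isInert_iff [Algebra.IsIntegral R S] (h : U ⋖ T) :
    IsInert U T ↔ ∀ x ∈ T, x ∉ conductorAddSubgroup U T →
      ∃ y ∈ T, x * y - 1 ∈ conductorAddSubgroup U T := by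
  rw [← conductor_isMaximal_iff h.lt]
  refine ⟨fun ⟨_, _, h3, _⟩ => h3, fun hmax => ⟨h.le, ?_, hmax, ?_⟩⟩
  · rw [isMaximal_iff_exists_mul_sub_one]
    refine ⟨one_notMem_conductor h.lt, fun x hx => ?_⟩
    obtain ⟨v, hv, h2⟩ := exists_mul_sub_one_mem_conductor h x.2 hx
    exact ⟨⟨v, hv⟩, h2⟩
  · constructor
    · intro htop
      refine h.lt.not_ge fun t ht => ?_
      have : Ideal.Quotient.mk (conductor U T) ⟨t, ht⟩ ∈ (residualMap h.le).range :=
        htop ▸ Subring.mem_top _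
      obtain ⟨y, hy⟩ := this
      obtain ⟨u, rfl⟩ := Ideal.Quotient.mk_surjective y
      have h1 : Ideal.Quotient.mk (conductor U T) (Subalgebra.inclusion h.le u) =
        Ideal.Quotient.mk (conductor U T) ⟨t, ht⟩ := hy
      have h2 : (u : S) - t ∈ U := mem_of_mem_conductor (T := T) (Ideal.Quotient.eq.1 h1)
      have := U.sub_mem u.2 h2
      simpa using this
    · intro W hW
      let W' : Subalgebra R S :=
        { carrier := {s | ∃ hs : s ∈ T, Ideal.Quotient.mk (conductor U T) ⟨s, hs⟩ ∈ W}
          mul_mem' := by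
            rintro a b ⟨ha, ha'⟩ ⟨hb, hb'⟩
            exact ⟨T.mul_mem ha hb, by
              have := W.mul_mem ha' hb'
              rwa [← map_mul] at this⟩
          add_mem' := by
            rintro a b ⟨ha, ha'⟩ ⟨hb, hb'⟩
            exact ⟨T.add_mem ha hb, by
              have := W.add_mem ha' hb'
              rwa [← map_add] at this⟩
          algebraMap_mem' := fun r => ⟨T.algebraMap_mem r, hW.le
            ⟨Ideal.Quotient.mk _ ⟨_, U.algebraMap_mem r⟩, rfl⟩⟩ }
      have hU : U ≤ W' := fun u hu => ⟨h.le hu, hW.le ⟨Ideal.Quotient.mk _ ⟨u, hu⟩, rfl⟩⟩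
      have hT : W' ≤ T := fun t ⟨ht, _⟩ => ht
      rcases h.eq_or_eq hU hT with e | e
      · refine absurd hW.le (fun _ => hW.not_ge fun z hz => ?_)
        obtain ⟨t, rfl⟩ := Ideal.Quotient.mk_surjective z
        have : (t : S) ∈ W' := ⟨t.2, hz⟩
        rw [e] at this
        exact ⟨Ideal.Quotient.mk _ ⟨t, this⟩, rfl⟩
      · rw [eq_top_iff]
        intro z _
        obtain ⟨t, rfl⟩ := Ideal.Quotient.mk_surjective z
        have : (t : S) ∈ W' := by rw [e]; exact t.2
        exact this.2

/-- A minimal integral extension `U ⊂ T` that is not inert is `U + U x` where `x ^ 2 - r x` lies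
in the conductor for some `r ∈ U`. -/
theorem exists_generator_of_not_isInert [Algebra.IsIntegral R S] (h : U ⋖ T)
    (hn : ¬ IsInert U T) :
    ∃ x ∈ T, x ∉ U ∧ (∃ r ∈ U, x ^ 2 - r * x ∈ conductorAddSubgroup U T) ∧
      ∀ t ∈ T, ∃ u ∈ U, ∃ v ∈ U, u + v * x = t := by
  rw [isInert_iff h] at hn
  push Not at hn
  obtain ⟨y, hyT, hyC, hy⟩ := hn
  -- A non-unit `y` modulo the conductor is a zero divisor there. Otherwise `T = U + y ^ 2 T` gives
  -- `y (1 - y s) ∈ U`: outside the conductor this element is a unit modulo it, inside it forces `y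
  -- s ≡ 1`, and either way `y` is a unit.
  obtain ⟨a, haT, haC, hay⟩ : ∃ a ∈ T, a ∉ conductorAddSubgroup U T ∧
      a * y ∈ conductorAddSubgroup U T := by
    by_contra! hcon
    have hy2 : y * y ∉ conductorAddSubgroup U T := hcon y hyT hyC
    obtain ⟨u, hu, s, hs, e⟩ := exists_add_mul_eq_of_covBy h (T.mul_mem hyT hyT) hy2 hyT
    have hu' : u = y * (1 - y * s) := by linear_combination e
    have huC : u ∈ conductorAddSubgroup U T := by
      by_contra huC
      obtain ⟨v, hv, h3⟩ := exists_mul_sub_one_mem_conductor h hu huC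
      refine hy ((1 - y * s) * v) (T.mul_mem (T.sub_mem T.one_mem (T.mul_mem hyT hs)) (h.le hv)) ?_
      rwa [← mul_assoc, ← hu']
    by_cases hz : 1 - y * s ∈ conductorAddSubgroup U T
    · refine hy s hs ?_
      have := (conductorAddSubgroup U T).neg_mem hz
      simpa using this
    · refine hcon _ (T.sub_mem T.one_mem (T.mul_mem hyT hs)) hz ?_
      rwa [mul_comm, ← hu']
  -- As `T = U + a T` and `a` kills `y` modulo the conductor, `y T` reduces to `U y`.
  have key : ∀ t ∈ T, ∃ v ∈ U, y * t - v * y ∈ conductorAddSubgroup U T := by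
    intro t ht
    obtain ⟨v, hv, s, hs, rfl⟩ := exists_add_mul_eq_of_covBy h haT haC ht
    refine ⟨v, hv, ?_⟩
    have := conductor_mul_mem hay hs
    convert this using 1; ring
  have gen : ∀ t ∈ T, ∃ u ∈ U, ∃ v ∈ U, u + v * y = t := by
    intro t ht
    obtain ⟨u, hu, s, hs, rfl⟩ := exists_add_mul_eq_of_covBy h hyT hyC ht
    obtain ⟨v, hv, h3⟩ := key s hs
    exact ⟨u + (y * s - v * y), U.add_mem hu (mem_of_mem_conductor h3), v, hv, by ring⟩
  refine ⟨y, hyT, fun hyU => h.lt.not_ge fun t ht => ?_, ?_, gen⟩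
  · obtain ⟨u, hu, v, hv, rfl⟩ := gen t ht
    exact U.add_mem hu (U.mul_mem hv hyU)
  · obtain ⟨v, hv, h3⟩ := key y hyT
    exact ⟨v, hv, by rwa [pow_two]⟩

end Conductor

end RingExt

namespace RingExt

/-! ### Consecutive inert and non-inert steps -/

section Exchange

variable {R S : Type*} [CommRing R] [CommRing S] [Algebra R S] [Algebra.IsIntegral R S]
  {U T V : Subalgebra R S}

/-- A minimal inert extension followed by a minimal non-inert one with a different conductor can be
exchanged for a minimal non-inert extension followed by a minimal inert one. -/
theorem exists_exchange (h : U ⋖ T) (hi : IsInert U T) (h' : T ⋖ V) (hn : ¬ IsInert T V)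
    (hne : conductorSet U T ≠ conductorSet T V) :
    ∃ T' : Subalgebra R S, U ⋖ T' ∧ ¬ IsInert U T' ∧ T' ⋖ V ∧ IsInert T' V := by
  rw [isInert_iff h] at hi
  set M := conductorAddSubgroup U T with hM
  set Q := conductorAddSubgroup T V with hQ
  have hMU : ∀ m ∈ M, m ∈ U := fun m hm => mem_of_mem_conductor hm
  have hQT : ∀ q ∈ Q, q ∈ T := fun m hm => mem_of_mem_conductor hm
  have hQV : ∀ q ∈ Q, ∀ v ∈ V, q * v ∈ Q := fun q hq v hv => conductor_mul_mem hq hv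
  have hMT : ∀ m ∈ M, ∀ t ∈ T, m * t ∈ M := fun q hq v hv => conductor_mul_mem hq hv
  have hQmax : ∀ t ∈ T, t ∉ Q → ∃ s ∈ T, t * s - 1 ∈ Q := fun t ht htQ =>
    exists_mul_sub_one_mem_conductor h' ht htQ
  -- `M` and `Q` are distinct maximal ideals of `T`, hence comaximal.
  obtain ⟨m, hm, hmq⟩ : ∃ m ∈ M, 1 - m ∈ Q := by
    by_cases hle : ∀ m ∈ M, m ∈ Q
    · obtain ⟨q, hq, hqM⟩ : ∃ q ∈ Q, q ∉ M := by
        by_contra! hcon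
        exact hne (Set.Subset.antisymm hle hcon)
      obtain ⟨t, ht, h3⟩ := hi q (hQT q hq) hqM
      refine ⟨1 - q * t, by simpa using M.neg_mem h3, ?_⟩
      simpa using hQV q hq t (h'.le ht)
    · push Not at hle
      obtain ⟨m, hm, hmQ⟩ := hle
      obtain ⟨t, ht, h3⟩ := hQmax m (h.le (hMU m hm)) hmQ
      exact ⟨m * t, hMT m hm t ht, by simpa using Q.neg_mem h3⟩
  have hmU := hMU m hm
  -- `I` extends `M` to an ideal of `V` with `I ∩ T = M` and `T + I = V`, so `V / I` is `T / M`. The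
  -- new ring `T' = U + I` corresponds to `U / M`.
  let I : AddSubgroup S :=
    { carrier := {v | v ∈ V ∧ ∀ q ∈ Q, q * v ∈ M}
      zero_mem' := ⟨V.zero_mem, fun q _ => by simp [M.zero_mem]⟩
      add_mem' := fun {a b} ha hb => ⟨V.add_mem ha.1 hb.1, fun q hq => by
        rw [mul_add]; exact M.add_mem (ha.2 q hq) (hb.2 q hq)⟩
      neg_mem' := fun {a} ha => ⟨V.neg_mem ha.1, fun q hq => by
        rw [mul_neg]; exact M.neg_mem (ha.2 q hq)⟩ }
  have hIV : ∀ i ∈ I, i ∈ V := fun i hi => hi.1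
  have hVI : ∀ v ∈ V, ∀ i ∈ I, v * i ∈ I := fun v hv i hi =>
    ⟨V.mul_mem hv hi.1, fun q hq => by
      have := hi.2 (q * v) (hQV q hq v hv)
      rwa [mul_assoc] at this⟩
  have hmI : ∀ v ∈ V, m * v ∈ I := fun v hv =>
    ⟨V.mul_mem (h'.le (h.le hmU)) hv, fun q hq => by
      have := hMT m hm _ (hQT _ (hQV q hq v hv))
      convert this using 1; ring⟩
  have hIT : ∀ i ∈ I, i ∈ T → i ∈ M := fun i hi hiT => by
    have := M.add_mem (hMT m hm i hiT) (hi.2 _ hmq)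
    convert this using 1; ring
  have hMI : ∀ i ∈ M, i ∈ I := fun i hi => ⟨h'.le (h.le (hMU i hi)), fun q hq => by
    rw [mul_comm]; exact hMT i hi q (hQT q hq)⟩
  have hqV : ∀ v ∈ V, (1 - m) * v ∈ Q := fun v hv => hQV _ hmq v hv
  have hVTI : ∀ v ∈ V, ∃ t ∈ T, ∃ i ∈ I, t + i = v := fun v hv =>
    ⟨_, hQT _ (hqV v hv), _, hmI v hv, by ring⟩
  let T' : Subalgebra R S := addSubgroupSup U I (fun u hu => hVI u (h'.le (h.le hu)))
    (fun i hi => hVI i (hIV i hi))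
  have hUT' : U ≤ T' := le_addSubgroupSup
  have hIT' : ∀ i ∈ I, i ∈ T' := fun i hi => mem_addSubgroupSup_of_mem hi
  have hT'V : T' ≤ V := addSubgroupSup_le (h.le.trans h'.le) hIV
  have hTT' : ∀ t ∈ T, t ∈ T' → t ∈ U := by
    rintro _ ht ⟨u, hu, i, hi, rfl⟩
    refine U.add_mem hu (hMU i (hIT i hi ?_))
    simpa using T.sub_mem ht (h.le hu)
  have hlt : U < T' := by
    refine lt_of_le_of_ne hUT' fun e => h'.lt.not_ge fun v hv => ?_
    obtain ⟨t, ht, i, hi, rfl⟩ := hVTI v hv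
    exact T.add_mem ht (h.le (e ▸ hIT' i hi))
  -- A ring `W` in between yields `T + (I ∩ W)` between `T` and `V`.
  have hcov : U ⋖ T' := by
    refine ⟨hlt, fun W hUW hWT' => ?_⟩
    let J : AddSubgroup S := I ⊓ W.toSubring.toAddSubgroup
    have hJ : ∀ j, j ∈ J ↔ j ∈ I ∧ j ∈ W := fun j => Iff.rfl
    let W' : Subalgebra R S := addSubgroupSup T J
      (fun t ht j hj => by
        rw [hJ] at hj ⊢
        refine ⟨hVI t (h'.le ht) j hj.1, ?_⟩
        have h1 : (m * t) * j ∈ W := W.mul_mem (hUW.le (hMU _ (hMT m hm t ht))) hj.2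
        have h2 : ((1 - m) * j) * t ∈ W := hUW.le (hMU _ (hMT _ (hj.1.2 _ hmq) t ht))
        have := W.add_mem h1 h2
        convert this using 1; ring)
      (fun i hi j hj => ⟨hVI i (hIV i hi.1) j hj.1, W.mul_mem hi.2 hj.2⟩)
    rcases h'.eq_or_eq (c := W') le_addSubgroupSup
      (addSubgroupSup_le h'.le fun j hj => hIV j hj.1) with e | e
    · refine hUW.not_ge fun w hw => ?_
      obtain ⟨u, hu, i, hi, rfl⟩ := hWT'.le hw
      have hiW : i ∈ W := by simpa using W.sub_mem hw (hUW.le hu)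
      have hiT : i ∈ W' := mem_addSubgroupSup_of_mem ⟨hi, hiW⟩
      rw [e] at hiT
      exact U.add_mem hu (hMU i (hIT i hi hiT))
    · refine hWT'.not_ge ?_
      rintro _ ⟨u, hu, i, hi, rfl⟩
      refine W.add_mem (hUW.le hu) ?_
      have hiW' : i ∈ W' := by rw [e]; exact hIV i hi
      obtain ⟨t, ht, j, hj, rfl⟩ := hiW'
      have htI : t ∈ I := by simpa using I.sub_mem hi hj.1
      exact W.add_mem (hUW.le (hMU t (hIT t htI ht))) hj.2
  -- A ring `W` in between is recovered from `W ∩ T`, which lies between `U` and `T`.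
  have hcov' : T' ⋖ V := by
    refine ⟨lt_of_le_of_ne hT'V fun e => h.lt.not_ge fun t ht => hTT' t ht ?_,
      fun W hTW hWV => ?_⟩
    · rw [e]; exact h'.le ht
    · rcases h.eq_or_eq (c := W ⊓ T) (le_inf (hUT'.trans hTW.le) h.le) inf_le_right with e | e
      · refine hTW.not_ge fun w hw => ?_
        obtain ⟨t, ht, i, hi, rfl⟩ := hVTI w (hWV.le hw)
        have htW : t ∈ W := by simpa using W.sub_mem hw (hTW.le (hIT' i hi))
        have htU : t ∈ W ⊓ T := Algebra.mem_inf.2 ⟨htW, ht⟩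
        rw [e] at htU
        exact T'.add_mem (hUT' htU) (hIT' i hi)
      · refine hWV.not_ge fun v hv => ?_
        obtain ⟨t, ht, i, hi, rfl⟩ := hVTI v hv
        have htW : t ∈ W ⊓ T := by rw [e]; exact ht
        exact W.add_mem (Algebra.mem_inf.1 htW).1 (hTW.le (hIT' i hi))
  have hIC : ∀ i ∈ I, i ∈ conductorAddSubgroup T' V := fun i hi v hv =>
    hIT' _ (mul_comm v i ▸ hVI v hv i hi)
  refine ⟨T', hcov, ?_, hcov', ?_⟩
  · rw [isInert_iff hcov]
    rw [isInert_iff h'] at hn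
    -- Since `m ≡ 1` modulo `Q`, the element `m x ∈ T'` represents `x`; inverting it in `T'` modulo
    -- `(U : T') ⊆ Q` would make `T ⊂ V` inert.
    refine fun hmax => hn fun x hx hxQ => ?_
    have hQC : ∀ u ∈ U, u ∈ Q → u ∈ conductorAddSubgroup U T' := fun u hu huQ t ht =>
      hTT' _ (hQT _ (hQV u huQ t (hT'V ht))) (T'.mul_mem (hUT' hu) ht)
    have hCQ : ∀ c ∈ conductorAddSubgroup U T', c ∈ Q := by
      intro c hc
      by_contra hcQ
      have hcU : c ∈ U := mem_of_mem_conductor hc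
      obtain ⟨s, hs, h3⟩ := hQmax c (h.le hcU) hcQ
      have hmsU : m * s ∈ U := hMU _ (hMT m hm s hs)
      have h4 : c * (m * s) - 1 ∈ Q := by
        have := Q.sub_mem h3 (hQV _ hmq (c * s) (h'.le (T.mul_mem (h.le hcU) hs)))
        convert this using 1; ring
      have h5 := hQC _ (U.sub_mem (U.mul_mem hcU hmsU) U.one_mem) h4
      have h6 := AddSubgroup.sub_mem _ (conductor_mul_mem hc (hUT' hmsU)) h5
      exact one_notMem_conductor hlt (by simpa using h6)
    have hmx : m * x ∉ Q := fun hmx => hxQ (by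
      have := Q.add_mem hmx (hqV x hx)
      convert this using 1; ring)
    obtain ⟨y, hy, h3⟩ := hmax (m * x) (hIT' _ (hmI x hx)) fun hc => hmx (hCQ _ hc)
    refine ⟨y, hT'V hy, ?_⟩
    have := Q.add_mem (hCQ _ h3) (hqV (x * y) (V.mul_mem hx (hT'V hy)))
    convert this using 1; ring
  · rw [isInert_iff hcov']
    intro x hx hxC
    obtain ⟨t, ht, i, hiI, rfl⟩ := hVTI x hx
    have htM : t ∉ M := fun htM => hxC (hIC _ (I.add_mem (hMI t htM) hiI))
    obtain ⟨s, hs, h3⟩ := hi t ht htM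
    refine ⟨s, h'.le hs, hIC _ ?_⟩
    have := I.add_mem (hMI _ h3) (hVI s (h'.le hs) i hiI)
    convert this using 1; ring

/-- If `U ⊂ T` is minimal inert and `T ⊂ V` is minimal non-inert with the same conductor, then
`V = T + T x` where `x ^ 2 - r x` lies in the conductor for some `r ∈ U`. -/
theorem exists_generator_of_conductorSet_eq (h : U ⋖ T) (hi : IsInert U T) (h' : T ⋖ V)
    (hn : ¬ IsInert T V) (he : conductorSet U T = conductorSet T V) :
    ∃ x ∈ V, x ∉ T ∧ ∃ r ∈ U, x ^ 2 - r * x ∈ conductorAddSubgroup T V := by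
  rw [isInert_iff h] at hi
  have hC : conductorAddSubgroup U T = conductorAddSubgroup T V := SetLike.coe_injective he
  obtain ⟨x, hx, hxT, ⟨r, hr, h2⟩, -⟩ := exists_generator_of_not_isInert h' hn
  -- Modulo the conductor, `r ∈ T` is zero or a unit. In the second case rescaling `x` by the
  -- inverse of `r` makes it idempotent, so the coefficient can be taken to be `0` or `1`, both in
  -- `U`.
  by_cases hrC : r ∈ conductorAddSubgroup T V
  · refine ⟨x, hx, hxT, 0, U.zero_mem, ?_⟩
    have := AddSubgroup.add_mem _ h2 (conductor_mul_mem hrC hx)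
    convert this using 1; ring
  · obtain ⟨s, hs, h3⟩ := hi r hr (hC ▸ hrC)
    rw [hC] at h3
    refine ⟨s * x, V.mul_mem (h'.le hs) hx, fun hsx => hxT ?_, 1, U.one_mem, ?_⟩
    · have := T.sub_mem (T.mul_mem hr hsx) (mem_of_mem_conductor (conductor_mul_mem h3 hx))
      convert this using 1; ring
    · have h4 := conductor_mul_mem h2 (V.mul_mem (h'.le hs) (h'.le hs))
      have h5 := conductor_mul_mem h3 (V.mul_mem (h'.le hs) hx)
      have := AddSubgroup.add_mem _ h4 h5
      convert this using 1; ring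

/-- If `U ⊂ T` is minimal inert and `T ⊂ V` is minimal non-inert with the same conductor, then
there is a chain of length three from `U` to `V` that avoids `T`. -/
theorem exists_longer_chain (h : U ⋖ T) (hi : IsInert U T) (h' : T ⋖ V)
    (hn : ¬ IsInert T V) (he : conductorSet U T = conductorSet T V) :
    ∃ A A' : Subalgebra R S, U < A ∧ A < A' ∧ A' < V ∧ A ≠ T ∧ A' ≠ T := by
  obtain ⟨x, hx, hxT, r, hr, h2⟩ := exists_generator_of_conductorSet_eq h hi h' hn he
  have hC : conductorAddSubgroup U T = conductorAddSubgroup T V := SetLike.coe_injective he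
  have hCU : ∀ c ∈ conductorAddSubgroup T V, c ∈ U := fun c hc => by
    rw [← hC] at hc; exact mem_of_mem_conductor hc
  -- `U + W x` is a ring because the common conductor lies in `U` and `x ^ 2 ≡ r x`. It is used for
  -- `W = U` and `W = T`.
  have build : ∀ W : Subalgebra R S, U ≤ W → W ≤ T → ∃ A : Subalgebra R S,
      ∀ s, s ∈ A ↔ ∃ u ∈ U, ∃ w ∈ W, u + w * x = s := by
    intro W hUW hWT
    let J : AddSubgroup S := (conductorAddSubgroup T V) ⊔
      W.toSubring.toAddSubgroup.map (AddMonoidHom.mulRight x)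
    have hJ : ∀ j, j ∈ J ↔ ∃ c ∈ conductorAddSubgroup T V, ∃ w ∈ W, c + w * x = j := by
      intro j
      rw [AddSubgroup.mem_sup]
      constructor
      · rintro ⟨c, hc, _, ⟨w, hw, rfl⟩, rfl⟩
        exact ⟨c, hc, w, hw, rfl⟩
      · rintro ⟨c, hc, w, hw, rfl⟩
        exact ⟨c, hc, _, ⟨w, hw, rfl⟩, rfl⟩
    refine ⟨addSubgroupSup U J ?_ ?_, fun s => ?_⟩
    · intro u hu j hj
      obtain ⟨c, hc, w, hw, rfl⟩ := (hJ j).1 hj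
      exact (hJ _).2 ⟨u * c, mul_conductor_mem (h'.le (h.le hu)) hc, u * w,
        W.mul_mem (hUW hu) hw, by ring⟩
    · intro i hi j hj
      obtain ⟨c, hc, w, hw, rfl⟩ := (hJ j).1 hj
      obtain ⟨d, hd, z, hz, rfl⟩ := (hJ i).1 hi
      have hwV := h'.le (hWT hw)
      have hzV := h'.le (hWT hz)
      refine (hJ _).2 ⟨c * (d + z * x) + d * (w * x) + (x ^ 2 - r * x) * (w * z), ?_,
        w * z * r, W.mul_mem (W.mul_mem hw hz) (hUW hr), by ring⟩
      refine AddSubgroup.add_mem _ (AddSubgroup.add_mem _ ?_ ?_) ?_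
      · exact conductor_mul_mem hc
          (V.add_mem (h'.le (mem_of_mem_conductor hd)) (V.mul_mem hzV hx))
      · exact conductor_mul_mem hd (V.mul_mem hwV hx)
      · exact conductor_mul_mem h2 (V.mul_mem hwV hzV)
    · rw [mem_addSubgroupSup]
      constructor
      · rintro ⟨u, hu, j, hj, rfl⟩
        obtain ⟨c, hc, w, hw, rfl⟩ := (hJ j).1 hj
        exact ⟨u + c, U.add_mem hu (hCU c hc), w, hw, by ring⟩
      · rintro ⟨u, hu, w, hw, rfl⟩
        exact ⟨u, hu, w * x, (hJ _).2 ⟨0, AddSubgroup.zero_mem _, w, hw, by ring⟩, rfl⟩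
  obtain ⟨A, hA⟩ := build U le_rfl h.le
  obtain ⟨A', hA'⟩ := build T h.le le_rfl
  have hxA : x ∈ A := (hA x).2 ⟨0, U.zero_mem, 1, U.one_mem, by ring⟩
  have hAA' : A ≤ A' := fun s hs => by
    obtain ⟨u, hu, w, hw, rfl⟩ := (hA s).1 hs
    exact (hA' _).2 ⟨u, hu, w, h.le hw, rfl⟩
  -- Otherwise `t` is a unit modulo the conductor and `x ∈ T`. All the strict inclusions rest on
  -- this or on `x ∉ T`.
  have htx : ∀ t ∈ T, t * x ∈ T → t ∈ conductorAddSubgroup T V := by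
    intro t ht htx
    by_contra htC
    obtain ⟨s, hs, h3⟩ := exists_mul_sub_one_mem_conductor h' ht htC
    refine hxT ?_
    have := T.sub_mem (T.mul_mem hs htx) (mem_of_mem_conductor (conductor_mul_mem h3 hx))
    convert this using 1; ring
  obtain ⟨t, htT, htU⟩ := Set.exists_of_ssubset h.lt
  refine ⟨A, A', lt_of_le_of_ne (fun u hu => (hA u).2 ⟨u, hu, 0, U.zero_mem, by ring⟩) ?_,
    lt_of_le_of_ne hAA' ?_, lt_of_le_of_ne (fun s hs => ?_) ?_, ?_, ?_⟩
  · rintro rfl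
    exact hxT (h.le hxA)
  · intro e
    have : t * x ∈ A := by
      rw [e]; exact (hA' _).2 ⟨0, U.zero_mem, t, htT, by ring⟩
    obtain ⟨u, hu, w, hw, e2⟩ := (hA _).1 this
    have h4 : (t - w) * x ∈ T := by
      have : (t - w) * x = u := by linear_combination -e2
      rw [this]; exact h.le hu
    have h5 := hCU _ (htx (t - w) (T.sub_mem htT (h.le hw)) h4)
    exact htU (by simpa using U.add_mem h5 hw)
  · obtain ⟨u, hu, w, hw, rfl⟩ := (hA' s).1 hs
    exact V.add_mem (h'.le (h.le hu)) (V.mul_mem (h'.le hw) hx)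
  · intro e
    have : t ∈ A' := by rw [e]; exact h'.le htT
    obtain ⟨u, hu, w, hw, e2⟩ := (hA' _).1 this
    have h4 : w * x ∈ T := by
      have : w * x = t - u := by linear_combination e2
      rw [this]; exact T.sub_mem htT (h.le hu)
    have h5 := htx w hw h4
    refine htU ?_
    rw [← e2]
    refine U.add_mem hu (hCU _ (conductor_mul_mem h5 hx))
  · rintro rfl
    exact hxT hxA
  · rintro rfl
    exact hxT (hAA' hxA)

end Exchange

end RingExt

namespace RingExt

/-! ### t-closed subrings and inert steps -/

section TClosed

variable {R S : Type*} [CommRing R] [CommRing S] [Algebra R S] {U T V B : Subalgebra R S}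

theorem isTClosed_iff : IsTClosed B S ↔
    ∀ b : S, ∀ r ∈ B, b ^ 2 - r * b ∈ B → b ^ 3 - r * b ^ 2 ∈ B → b ∈ B := by
  have key : ∀ x : S, x ∈ Set.range (algebraMap B S) ↔ x ∈ B :=
    fun x => ⟨by rintro ⟨y, rfl⟩; exact y.2, fun h => ⟨⟨x, h⟩, rfl⟩⟩
  constructor
  · intro h b r hr h2 h3
    exact (key b).1 (h b ⟨r, hr⟩ ((key _).2 h2) ((key _).2 h3))
  · intro h b r h2 h3
    exact (key b).2 (h b r r.2 ((key _).1 h2) ((key _).1 h3))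

theorem isTClosed_tClosure : IsTClosed (tClosure R S) S := (tClosure_isLeast R S).1

theorem wellFoundedGT_of_hasFCP (h : HasFCP R S) : WellFoundedGT (Subalgebra R S) := by
  rw [WellFoundedGT, isWellFounded_iff, RelEmbedding.wellFounded_iff_isEmpty]
  refine ⟨fun f => ?_⟩
  have hf : StrictMono f := fun a b hab => f.map_rel_iff.2 hab
  exact Set.infinite_range_of_injective hf.injective (h _ hf.monotone.isChain_range)

theorem wellFoundedLT_of_hasFCP (h : HasFCP R S) : WellFoundedLT (Subalgebra R S) := by
  rw [WellFoundedLT, isWellFounded_iff, RelEmbedding.wellFounded_iff_isEmpty]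
  refine ⟨fun f => ?_⟩
  have hf : StrictAnti f := fun a b hab => f.map_rel_iff.2 hab
  refine Set.infinite_range_of_injective hf.injective (h _ ?_)
  exact (hf.antitone.dual_right.isChain_range).symm

variable [Algebra.IsIntegral R S]

/-- If `b (b - r)` vanishes in the residue field of `T`, then `b ≡ 0` or `b ≡ r`. If not, it is a
unit of `U` modulo the conductor, and `b` is the quotient of `b ^ 3 - r b ^ 2` by it. -/
theorem mem_of_isInert (h : U ⋖ T) (hi : IsInert U T) {b r : S} (hb : b ∈ T) (hr : r ∈ U)
    (h2 : b ^ 2 - r * b ∈ U) (h3 : b ^ 3 - r * b ^ 2 ∈ U) : b ∈ U := by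
  rw [isInert_iff h] at hi
  by_cases hc : b ^ 2 - r * b ∈ conductorAddSubgroup U T
  · by_cases hbC : b ∈ conductorAddSubgroup U T
    · exact mem_of_mem_conductor hbC
    · obtain ⟨s, hs, h4⟩ := hi b hb hbC
      have h5 := AddSubgroup.sub_mem _ (conductor_mul_mem hc hs)
        (conductor_mul_mem h4 (T.sub_mem hb (h.le hr)))
      have h6 := U.add_mem hr (mem_of_mem_conductor h5)
      convert h6 using 1; ring
  · obtain ⟨v, hv, h4⟩ := exists_mul_sub_one_mem_conductor h h2 hc
    have h5 := U.sub_mem (U.mul_mem hv h3) (mem_of_mem_conductor (conductor_mul_mem h4 hb))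
    convert h5 using 1; ring

theorem isTClosed_of_isInert (h : U ⋖ T) (hi : IsInert U T) (hT : IsTClosed T S) :
    IsTClosed U S := by
  rw [isTClosed_iff] at hT ⊢
  exact fun b r hr h2 h3 => mem_of_isInert h hi (hT b r (h.le hr) (h.le h2) (h.le h3)) hr h2 h3

/-- A subring of a t-closed subring `B` is t-closed if its minimal overrings in `B` are inert. -/
theorem isTClosed_of_forall_isInert [WellFoundedLT (Subalgebra R S)] (hB : IsTClosed B S)
    (hUB : U ≤ B) (hU : ∀ T, U ⋖ T → T ≤ B → IsInert U T) : IsTClosed U S := by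
  rw [isTClosed_iff] at hB ⊢
  intro b r hr h2 h3
  by_contra hb
  let W : Subalgebra R S :=
    { carrier := {s | ∃ u ∈ U, ∃ v ∈ U, u + v * b = s}
      mul_mem' := by
        rintro _ _ ⟨u, hu, v, hv, rfl⟩ ⟨w, hw, z, hz, rfl⟩
        exact ⟨u * w + v * z * (b ^ 2 - r * b),
          U.add_mem (U.mul_mem hu hw) (U.mul_mem (U.mul_mem hv hz) h2), u * z + v * w + v * z * r,
          U.add_mem (U.add_mem (U.mul_mem hu hz) (U.mul_mem hv hw))
            (U.mul_mem (U.mul_mem hv hz) hr), by ring⟩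
      add_mem' := by
        rintro _ _ ⟨u, hu, v, hv, rfl⟩ ⟨w, hw, z, hz, rfl⟩
        exact ⟨u + w, U.add_mem hu hw, v + z, U.add_mem hv hz, by ring⟩
      algebraMap_mem' := fun r => ⟨_, U.algebraMap_mem r, 0, U.zero_mem, by ring⟩ }
  have hUW : U < W := by
    refine lt_of_le_of_ne (fun u hu => ⟨u, hu, 0, U.zero_mem, by ring⟩) fun e => hb ?_
    rw [e]
    exact ⟨0, U.zero_mem, 1, U.one_mem, by ring⟩
  have hWB : W ≤ B := by
    rintro _ ⟨u, hu, v, hv, rfl⟩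
    exact B.add_mem (hUB hu) (B.mul_mem (hUB hv) (hB b r (hUB hr) (hUB h2) (hUB h3)))
  -- `T` contains some `v b ∉ U` with `v ∈ U`, and `v b` satisfies the two t-closedness conditions
  -- with `v r` in place of `r`.
  obtain ⟨T, hT, hTW⟩ := exists_covBy_le_of_lt hUW
  obtain ⟨y, hyT, hyU⟩ := Set.exists_of_ssubset hT.lt
  obtain ⟨u, hu, v, hv, rfl⟩ := hTW hyT
  have hvb : v * b ∈ T := by simpa using T.sub_mem hyT (hT.le hu)
  refine hyU (U.add_mem hu ?_)
  refine mem_of_isInert hT (hU T hT (hTW.trans hWB)) hvb (U.mul_mem hv hr) ?_ ?_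
  · have := U.mul_mem (U.pow_mem hv 2) h2
    convert this using 1; ring
  · have := U.mul_mem (U.pow_mem hv 3) h3
    convert this using 1; ring

/-- A minimal non-inert extension of a subring of a t-closed subring `B` stays in `B`. -/
theorem le_of_not_isInert (hB : IsTClosed B S) (hUB : U ≤ B) (h : U ⋖ T) (hn : ¬ IsInert U T) :
    T ≤ B := by
  rw [isTClosed_iff] at hB
  obtain ⟨x, hx, -, ⟨r, hr, h2⟩, h3⟩ := exists_generator_of_not_isInert h hn
  intro t ht
  obtain ⟨u, hu, v, hv, rfl⟩ := h3 t ht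
  refine B.add_mem (hUB hu) (B.mul_mem (hUB hv) (hB x r (hUB hr) ?_ ?_))
  · exact hUB (mem_of_mem_conductor h2)
  · have := hUB (mem_of_mem_conductor (conductor_mul_mem h2 hx))
    convert this using 1; ring

theorem isInert_of_isTClosed (hU : IsTClosed U S) (h : U ⋖ T) : IsInert U T := by
  by_contra hn
  exact h.lt.not_ge (le_of_not_isInert hU le_rfl h hn)

/-- Were the second step non-inert, equal conductors would give a generator outside `T` that
t-closedness puts in `U`, and distinct ones a non-inert step starting at `U` by exchange. -/
theorem isInert_of_isInert_of_isTClosed (hU : IsTClosed U S) (h : U ⋖ T) (h' : T ⋖ V) :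
    IsInert T V := by
  have hi := isInert_of_isTClosed hU h
  by_contra hn
  by_cases he : conductorSet U T = conductorSet T V
  · obtain ⟨x, hx, hxT, r, hr, h2⟩ := exists_generator_of_conductorSet_eq h hi h' hn he
    have hC : conductorAddSubgroup U T = conductorAddSubgroup T V := SetLike.coe_injective he
    refine hxT (h.le ((isTClosed_iff.1 hU) x r hr ?_ ?_))
    · rw [← hC] at h2
      exact mem_of_mem_conductor h2
    · have := conductor_mul_mem h2 hx
      rw [← hC] at this
      convert mem_of_mem_conductor this using 1; ring
  · obtain ⟨T', h1, h2, -⟩ := exists_exchange h hi h' hn he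
    exact h2 (isInert_of_isTClosed hU h1)

/-- If `U` is t-closed in `S`, then so is each ring between `U` and `S`. -/
theorem IsTClosed.mono [WellFoundedLT (Subalgebra R S)] [WellFoundedGT (Subalgebra R S)]
    (hU : IsTClosed U S) (hUT : U ≤ T) : IsTClosed T S := by
  -- t-closedness passes from `W` to any cover of `W`, so a maximal t-closed ring between `U` and
  -- `T` is `T`.
  obtain ⟨W, ⟨⟨hUW, hWT, hW⟩, hmax⟩⟩ := exists_maximal_of_wellFoundedGT
    (fun W : Subalgebra R S => U ≤ W ∧ W ≤ T ∧ IsTClosed W S) ⟨U, le_rfl, hUT, hU⟩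
  rcases hWT.eq_or_lt with rfl | hlt
  · exact hW
  · obtain ⟨W', h1, h2⟩ := exists_covBy_le_of_lt hlt
    have htop : IsTClosed (⊤ : Subalgebra R S) S :=
      isTClosed_iff.2 fun _ _ _ _ _ => Algebra.mem_top
    have hW' : IsTClosed W' S := isTClosed_of_forall_isInert htop le_top
      fun V hV _ => isInert_of_isInert_of_isTClosed hW h1 hV
    exact absurd (hmax ⟨hUW.trans h1.le, h2, hW'⟩ h1.le) h1.lt.not_ge

end TClosed

/-! ### Residue fields along non-inert steps -/

section InfraIntegral

variable {R S : Type*} [CommRing R] [CommRing S] [Algebra R S] {U T V B : Subalgebra R S}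

/-- The extension `R ⊆ U` induces isomorphisms of the residue fields, at the maximal ideals
of `S`. -/
def ResiduallyTrivial (U : Subalgebra R S) : Prop :=
  ∀ N : Ideal S, N.IsMaximal → ∀ u ∈ U, ∃ r : R, u - algebraMap R S r ∈ N

theorem residuallyTrivial_bot : ResiduallyTrivial (⊥ : Subalgebra R S) := by
  intro N _ u hu
  obtain ⟨r, rfl⟩ := Algebra.mem_bot.1 hu
  exact ⟨r, by simp⟩

variable [Algebra.IsIntegral R S]

theorem exists_mul_sub_one_mem (N : Ideal S) [N.IsMaximal] {r : R} (hr : algebraMap R S r ∉ N) :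
    ∃ s : R, algebraMap R S (r * s) - 1 ∈ N := by
  have hP : (N.comap (algebraMap R S)).IsMaximal :=
    Ideal.isMaximal_comap_of_isIntegral_of_isMaximal N
  obtain ⟨s, hs⟩ := (isMaximal_iff_exists_mul_sub_one.1 hP).2 r hr
  exact ⟨s, by simpa using hs⟩

/-- If `N` contains the conductor, the generator `x` is `0` or `r` modulo `N`. If not, some `c` in
the conductor is nonzero modulo `N`, and `t` is the quotient of `c t ∈ U` by `c ∈ U`. -/
theorem ResiduallyTrivial.of_covBy (hU : ResiduallyTrivial U) (h : U ⋖ T) (hn : ¬ IsInert U T) :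
    ResiduallyTrivial T := by
  obtain ⟨x, hx, -, ⟨r, hr, h2⟩, h3⟩ := exists_generator_of_not_isInert h hn
  intro N hN t ht
  by_cases hCN : ∀ c ∈ conductorAddSubgroup U T, c ∈ N
  · obtain ⟨u, hu, v, hv, rfl⟩ := h3 t ht
    have hp : x * (x - r) ∈ N := by
      have := hCN _ h2
      convert this using 1; ring
    rcases hN.isPrime.mem_or_mem hp with hxN | hxN
    · obtain ⟨s, hs⟩ := hU N hN u hu
      refine ⟨s, ?_⟩
      have := N.add_mem hs (N.mul_mem_left v hxN)
      convert this using 1; ring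
    · obtain ⟨s, hs⟩ := hU N hN (u + v * r) (U.add_mem hu (U.mul_mem hv hr))
      refine ⟨s, ?_⟩
      have := N.add_mem hs (N.mul_mem_left v hxN)
      convert this using 1; ring
  · push Not at hCN
    obtain ⟨c, hc, hcN⟩ := hCN
    obtain ⟨a, ha⟩ := hU N hN c (mem_of_mem_conductor hc)
    obtain ⟨b, hb⟩ := hU N hN (c * t) (hc t ht)
    have haN : algebraMap R S a ∉ N := fun haN => hcN (by simpa using N.add_mem ha haN)
    obtain ⟨d, hd⟩ := exists_mul_sub_one_mem N haN
    refine ⟨d * b, ?_⟩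
    rw [map_mul] at hd ⊢
    have := N.add_mem (N.sub_mem (N.mul_mem_left (algebraMap R S d) hb) (N.mul_mem_right t hd))
      (N.mul_mem_left (-algebraMap R S d * t) ha)
    convert this using 1; ring

/-- A maximal residually trivial subring of the t-closure has only inert covers inside it, hence is
t-closed, hence is all of it. -/
theorem residuallyTrivial_tClosure [WellFoundedLT (Subalgebra R S)]
    [WellFoundedGT (Subalgebra R S)] : ResiduallyTrivial (tClosure R S) := by
  obtain ⟨W, ⟨⟨hWB, hW⟩, hmax⟩⟩ := exists_maximal_of_wellFoundedGT
    (fun W : Subalgebra R S => W ≤ tClosure R S ∧ ResiduallyTrivial W)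
    ⟨⊥, bot_le, residuallyTrivial_bot⟩
  have hcl : IsTClosed W S := isTClosed_of_forall_isInert isTClosed_tClosure hWB
    fun T hT hTB => by
      by_contra hn
      exact hT.lt.not_ge (hmax ⟨hTB, hW.of_covBy hT hn⟩ hT.le)
  rwa [← le_antisymm hWB ((tClosure_isLeast R S).2 hcl)]

theorem exists_isMaximal_over_conductor (h : U ⋖ T) :
    ∃ N : Ideal S, N.IsMaximal ∧ ∀ u ∈ U, u ∈ N ↔ u ∈ conductorAddSubgroup U T := by
  have hP : ((conductor U T).comap (Subalgebra.inclusion h.le).toRingHom).IsMaximal := by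
    rw [isMaximal_iff_exists_mul_sub_one]
    refine ⟨one_notMem_conductor h.lt, fun x hx => ?_⟩
    obtain ⟨v, hv, h2⟩ := exists_mul_sub_one_mem_conductor h x.2 hx
    exact ⟨⟨v, hv⟩, h2⟩
  have hint : Algebra.IsIntegral U S := Algebra.IsIntegral.tower_top (R := R)
  obtain ⟨N, hN, e⟩ := Ideal.exists_ideal_over_maximal_of_isIntegral (S := S)
    ((conductor U T).comap (Subalgebra.inclusion h.le).toRingHom) (by
      intro x hx
      have hx0 : x = 0 := Subtype.ext hx
      rw [hx0]; exact Ideal.zero_mem _)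
  refine ⟨N, hN, fun u hu => ?_⟩
  exact iff_of_eq (congrArg (fun I : Ideal U => (⟨u, hu⟩ : U) ∈ I) e)

theorem exists_conductorSet_eq_inter (h : U ⋖ T) (hi : IsInert U T) :
    ∃ N : Ideal S, N.IsMaximal ∧ conductorSet U T = (N : Set S) ∩ (T : Set S) := by
  obtain ⟨_, _, hmax, _⟩ := hi
  have hint : Algebra.IsIntegral T S := Algebra.IsIntegral.tower_top (R := R)
  obtain ⟨N, hN, e⟩ := Ideal.exists_ideal_over_maximal_of_isIntegral (S := S)
    (conductor U T) (by
      intro x hx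
      have hx0 : x = 0 := Subtype.ext hx
      rw [hx0]; exact Ideal.zero_mem _)
  refine ⟨N, hN, Set.ext fun x => ?_⟩
  have key : ∀ y : T, y ∈ N.comap (algebraMap T S) ↔ y ∈ conductor U T := fun y => by rw [e]
  constructor
  · intro hx
    have hxT : x ∈ T := h.le (mem_of_mem_conductor (T := T) hx)
    exact ⟨(key ⟨x, hxT⟩).2 hx, hxT⟩
  · rintro ⟨hx, hxT⟩
    exact (key ⟨x, hxT⟩).1 hx

/-- A minimal non-inert extension of a residually trivial `U` has no `R`-submodule strictly
between. -/
theorem ResiduallyTrivial.covBy_toSubmodule (hU : ResiduallyTrivial U) (h : U ⋖ T)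
    (hn : ¬ IsInert U T) : Subalgebra.toSubmodule U ⋖ Subalgebra.toSubmodule T := by
  obtain ⟨x, hx, -, -, h3⟩ := exists_generator_of_not_isInert h hn
  obtain ⟨N, hN, hNC⟩ := exists_isMaximal_over_conductor h
  -- `R` surjects onto the residue field of `U`, so scalars from `U` acting on `T / U` can be
  -- replaced by scalars from `R`.
  have hred : ∀ v ∈ U, ∃ r : R, v - algebraMap R S r ∈ conductorAddSubgroup U T := by
    intro v hv
    obtain ⟨r, hr⟩ := hU N hN v hv
    exact ⟨r, (hNC _ (U.sub_mem hv (U.algebraMap_mem r))).1 hr⟩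
  refine ⟨Subalgebra.toSubmodule.lt_iff_lt.2 h.lt, fun M hUM hMT => ?_⟩
  have hUM' : ∀ u ∈ U, u ∈ M := fun u hu => hUM.le hu
  obtain ⟨y, hyM, hyU⟩ := Set.exists_of_ssubset hUM
  obtain ⟨u, hu, v, hv, rfl⟩ := h3 y (hMT.le hyM)
  have hvx : v * x ∈ M := by simpa using M.sub_mem hyM (hUM' u hu)
  have hvC : v ∉ conductorAddSubgroup U T := fun hvC => hyU (U.add_mem hu (hvC x hx))
  obtain ⟨w, hw, hvw⟩ := exists_mul_sub_one_mem_conductor h hv hvC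
  refine hMT.not_ge fun t ht => ?_
  obtain ⟨a, ha, b, hb, rfl⟩ := h3 t ht
  obtain ⟨r, hr⟩ := hred (b * w) (U.mul_mem hb hw)
  have h1 : r • (v * x) ∈ M := M.smul_mem r hvx
  rw [Algebra.smul_def] at h1
  have h2 := hUM' _ (mem_of_mem_conductor
    (conductor_mul_mem hr (T.mul_mem (h.le hv) hx)))
  have h4 := hUM' _ (mem_of_mem_conductor
    (conductor_mul_mem hvw (T.mul_mem (h.le hb) hx)))
  have := M.add_mem (hUM' a ha) (M.sub_mem (M.add_mem h1 h2) h4)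
  convert this using 1; ring

end InfraIntegral

/-! ### Supports via saturation, and the ideals over conductors -/

section Support

variable {R S : Type*} [CommRing R] [CommRing S] [Algebra R S] {U T V B : Subalgebra R S}

theorem mem_MSupp_quotient {E : Type*} [AddCommGroup E] [Module R E] {p : Submodule R E}
    {P : Ideal R} : P ∈ MSupp R (E ⧸ p) ↔ P.IsMaximal ∧ ∃ m : E, ∀ r ∉ P, r • m ∉ p := by
  have key : ∀ m : E, ∀ r : R, r • (p.mkQ m) ≠ 0 ↔ r • m ∉ p := fun m r => by
    rw [← map_smul, ne_eq, Submodule.mkQ_apply, Submodule.Quotient.mk_eq_zero]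
  refine and_congr_right fun hP => ⟨?_, ?_⟩
  · rintro ⟨q, hq, rfl⟩
    obtain ⟨m, hm⟩ := Module.mem_support_iff'.1 hq
    obtain ⟨m, rfl⟩ := p.mkQ_surjective m
    exact ⟨m, fun r hr => (key m r).1 (hm r hr)⟩
  · rintro ⟨m, hm⟩
    exact ⟨⟨P, hP.isPrime⟩, Module.mem_support_iff'.2
      ⟨p.mkQ m, fun r hr => (key m r).2 (hm r hr)⟩, rfl⟩

/-- The elements of `S` with a multiple in `U` by an element of `R` outside `P`. -/
def localSaturation (P : Ideal R) [hP : P.IsPrime] (U : Subalgebra R S) : Subalgebra R S where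
  carrier := {s | ∃ r ∉ P, r • s ∈ U}
  mul_mem' := by
    rintro a b ⟨r, hr, ha⟩ ⟨s, hs, hb⟩
    refine ⟨r * s, hP.mul_notMem hr hs, ?_⟩
    have := U.mul_mem ha hb
    rwa [smul_mul_smul_comm] at this
  add_mem' := by
    rintro a b ⟨r, hr, ha⟩ ⟨s, hs, hb⟩
    refine ⟨r * s, hP.mul_notMem hr hs, ?_⟩
    have := U.add_mem (U.smul_mem ha s) (U.smul_mem hb r)
    rwa [smul_smul, smul_smul, mul_comm s r, ← smul_add] at this
  algebraMap_mem' := fun r => ⟨1, P.one_notMem, by simp [U.algebraMap_mem r]⟩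

variable {P : Ideal R} [hP : P.IsPrime]

theorem mem_localSaturation {s : S} : s ∈ localSaturation P U ↔ ∃ r ∉ P, r • s ∈ U := Iff.rfl

theorem le_localSaturation : U ≤ localSaturation P U := fun u hu =>
  ⟨1, P.one_notMem, by simpa using hu⟩

theorem localSaturation_mono (h : U ≤ T) : localSaturation P U ≤ localSaturation P T :=
  fun _ ⟨r, hr, h2⟩ => ⟨r, hr, h h2⟩

theorem localSaturation_localSaturation :
    localSaturation P (localSaturation P U) = localSaturation P U := by
  refine le_antisymm ?_ le_localSaturation
  rintro s ⟨r, hr, q, hq, h2⟩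
  exact ⟨q * r, hP.mul_notMem hq hr, by rwa [mul_smul]⟩

theorem isTClosed_localSaturation (hU : IsTClosed U S) : IsTClosed (localSaturation P U) S := by
  rw [isTClosed_iff] at hU ⊢
  rintro b r ⟨s, hs, hr⟩ ⟨q, hq, h2⟩ ⟨p, hp, h3⟩
  refine ⟨s * q * p, hP.mul_notMem (hP.mul_notMem hs hq) hp, ?_⟩
  rw [Algebra.smul_def] at *
  simp only [map_mul] at *
  have hs' := U.algebraMap_mem s
  have hq' := U.algebraMap_mem q
  have hp' := U.algebraMap_mem p
  generalize algebraMap R S s = s at *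
  generalize algebraMap R S q = q at *
  generalize algebraMap R S p = p at *
  -- Both `b` and `r` are scaled by `s q p`, which clears all three denominators.
  refine hU _ (q * p * (s * r)) (U.mul_mem (U.mul_mem hq' hp') hr) ?_ ?_
  · have := U.mul_mem (U.mul_mem (U.mul_mem (U.pow_mem hs' 2) hq') (U.pow_mem hp' 2)) h2
    convert this using 1; ring
  · have := U.mul_mem (U.mul_mem (U.mul_mem (U.pow_mem hs' 3) (U.pow_mem hq' 3))
      (U.pow_mem hp' 2)) h3
    convert this using 1; ring

theorem mem_MSupp_iff_localSaturation_ne_top {P : Ideal R} [hP : P.IsMaximal] :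
    P ∈ MSupp R (S ⧸ Subalgebra.toSubmodule U) ↔
      localSaturation (hP := hP.isPrime) P U ≠ ⊤ := by
  rw [mem_MSupp_quotient, and_iff_right hP, ne_eq, Algebra.eq_top_iff]
  push Not
  refine exists_congr fun m => ?_
  rw [mem_localSaturation]
  push Not
  exact Iff.rfl

theorem mem_MSupp_iff_not_le_localSaturation {P : Ideal R} [hP : P.IsMaximal] :
    P ∈ MSupp R (B ⧸ Subalgebra.toSubmodule (⊥ : Subalgebra R B)) ↔
      ¬ B ≤ localSaturation (hP := hP.isPrime) P ⊥ := by
  have key : ∀ b : B, b ∈ (⊥ : Subalgebra R B) ↔ (b : S) ∈ (⊥ : Subalgebra R S) := by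
    intro b
    rw [Algebra.mem_bot, Algebra.mem_bot]
    constructor
    · rintro ⟨r, rfl⟩
      exact ⟨r, rfl⟩
    · rintro ⟨r, hr⟩
      exact ⟨r, Subtype.ext hr⟩
  rw [mem_MSupp_quotient, and_iff_right hP]
  constructor
  · rintro ⟨b, hb⟩ hle
    obtain ⟨r, hr, h⟩ := hle b.2
    exact hb r hr ((key (r • b)).2 h)
  · intro h
    obtain ⟨b, hb, h2⟩ := Set.not_subset.1 h
    exact ⟨⟨b, hb⟩, fun r hr h3 => h2 ⟨r, hr, (key _).1 h3⟩⟩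

variable [Algebra.IsIntegral R S]

/-- On complements: as saturation is monotone and idempotent, that of `R` is `S` exactly when it
contains the t-closure and the t-closure saturates to `S`. -/
theorem M₁_union_M₂ : M₁ R S ∪ M₂ R S =
    {N : Ideal S | N.IsMaximal ∧ N.comap (algebraMap R S) ∈
      MSupp R (S ⧸ Subalgebra.toSubmodule (⊥ : Subalgebra R S))} := by
  ext N
  simp only [M₁, M₂, maxOverMSupp, Set.mem_union, Set.mem_ofPred_eq, ← and_or_left]
  refine and_congr_right fun hN => ?_
  have hP : (N.comap (algebraMap R S)).IsMaximal :=
    Ideal.isMaximal_comap_of_isIntegral_of_isMaximal N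
  have := hP.isPrime
  rw [mem_MSupp_iff_not_le_localSaturation, mem_MSupp_iff_localSaturation_ne_top,
    mem_MSupp_iff_localSaturation_ne_top]
  constructor
  · rintro (h | h) e
    · exact h (e ▸ le_top)
    · exact h (top_le_iff.1 (e ▸ localSaturation_mono bot_le))
  · intro h
    by_contra! hcon
    refine h (top_le_iff.1 ?_)
    rw [← hcon.2]
    exact (localSaturation_mono hcon.1).trans localSaturation_localSaturation.le

/-- Off the support, each `t ∈ T` has a multiple in the t-closure by a scalar outside `N`. Residual
triviality then gives `t ≡ a` modulo `N` with `a ∈ R`, so `t - a ∈ N ∩ T = (U : T)` and `T ≤ U`. -/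
theorem mem_M₂_of_isInert [WellFoundedLT (Subalgebra R S)] [WellFoundedGT (Subalgebra R S)]
    (h : U ⋖ T) {N : Ideal S} (hN : N.IsMaximal)
    (hNT : conductorSet U T = (N : Set S) ∩ (T : Set S)) : N ∈ M₂ R S := by
  have hP : (N.comap (algebraMap R S)).IsMaximal :=
    Ideal.isMaximal_comap_of_isIntegral_of_isMaximal N
  have := hP.isPrime
  refine ⟨hN, mem_MSupp_iff_localSaturation_ne_top.2 fun htop => h.lt.not_ge fun t ht => ?_⟩
  obtain ⟨r, hr, hrt⟩ : t ∈ localSaturation (N.comap (algebraMap R S)) (tClosure R S) :=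
    htop ▸ Algebra.mem_top
  obtain ⟨a, ha⟩ := residuallyTrivial_tClosure N hN _ hrt
  obtain ⟨s, hs⟩ := exists_mul_sub_one_mem N hr
  have hmem : t - algebraMap R S (s * a) ∈ conductorSet U T := by
    rw [hNT]
    refine ⟨?_, T.sub_mem ht (T.algebraMap_mem _)⟩
    rw [Algebra.smul_def] at ha
    rw [map_mul] at hs ⊢
    have := N.sub_mem (N.mul_mem_left (algebraMap R S s) ha) (N.mul_mem_right t hs)
    show t - algebraMap R S s * algebraMap R S a ∈ N
    convert this using 1; ring
  have := U.add_mem (mem_of_mem_conductor (T := T) hmem) (U.algebraMap_mem (s * a))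
  simpa using this

/-- Off the support, `R` and its t-closure have the same saturation, so the saturation of `T` is
t-closed and contains the generator `x`. A scalar `s ∉ N` with `s x ∈ T` then lies in `(T : V) = N ∩
T`, a contradiction. -/
theorem mem_M₁_of_not_isInert [WellFoundedLT (Subalgebra R S)] [WellFoundedGT (Subalgebra R S)]
    (h : T ⋖ V) (hn : ¬ IsInert T V) {N : Ideal S} (hN : N.IsMaximal)
    (hNT : conductorSet T V = (N : Set S) ∩ (T : Set S)) : N ∈ M₁ R S := by
  have hP : (N.comap (algebraMap R S)).IsMaximal :=
    Ideal.isMaximal_comap_of_isIntegral_of_isMaximal N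
  have := hP.isPrime
  refine ⟨hN, mem_MSupp_iff_not_le_localSaturation.2 fun hle => ?_⟩
  obtain ⟨x, hx, hxT, ⟨r, hr, h2⟩, h3⟩ := exists_generator_of_not_isInert h hn
  set P := N.comap (algebraMap R S) with hPdef
  have hsat : IsTClosed (localSaturation P T) S := by
    refine IsTClosed.mono (isTClosed_localSaturation (P := P) isTClosed_tClosure) ?_
    exact (localSaturation_mono hle).trans
      (localSaturation_localSaturation.le.trans (localSaturation_mono bot_le))
  obtain ⟨s, hs, hsx⟩ : x ∈ localSaturation P T := by
    refine isTClosed_iff.1 hsat x r (le_localSaturation hr)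
      (le_localSaturation (mem_of_mem_conductor h2)) (le_localSaturation ?_)
    have := mem_of_mem_conductor (conductor_mul_mem h2 hx)
    convert this using 1; ring
  refine hs ?_
  have hmem : algebraMap R S s ∈ conductorSet T V := by
    intro v hv
    obtain ⟨a, ha, b, hb, rfl⟩ := h3 v hv
    rw [Algebra.smul_def] at hsx
    have := T.add_mem (T.mul_mem (T.algebraMap_mem s) ha) (T.mul_mem hb hsx)
    convert this using 1; ring
  rw [hNT] at hmem
  exact hmem.1

end Support

end RingExt

namespace RingExt

/-! ### Covering paths and maximal chains in partial orders -/

section Order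

/-- `y` is reached from `x` by `n` steps of the relation `r`. -/
inductive StepPath {α : Type*} (r : α → α → Prop) : ℕ → α → α → Prop
  | refl (x : α) : StepPath r 0 x x
  | tail {n : ℕ} {x y z : α} : StepPath r n x y → r y z → StepPath r (n + 1) x z

variable {α : Type*}

theorem StepPath.mono {r s : α → α → Prop} (h : ∀ a b, r a b → s a b) {n : ℕ} {x y : α}
    (p : StepPath r n x y) : StepPath s n x y := by
  induction p with
  | refl x => exact .refl x
  | tail _ h2 ih => exact ih.tail (h _ _ h2)

theorem StepPath.exchange_step {r s : α → α → Prop}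
    (hex : ∀ a b c, s a b → r b c → ∃ b', r a b' ∧ s b' c) {n : ℕ} {x y : α}
    (p : StepPath s n x y) : ∀ {z : α}, r y z → ∃ w, r x w ∧ StepPath s n w z := by
  induction p with
  | refl x => exact fun {z} h => ⟨z, h, .refl z⟩
  | tail _ h2 ih =>
    intro z hz
    obtain ⟨b', h3, h4⟩ := hex _ _ _ h2 hz
    obtain ⟨w, h5, h6⟩ := ih h3
    exact ⟨w, h5, h6.tail h4⟩

/-- If an `s`-step followed by an `r`-step can be exchanged, each path can be sorted. -/
theorem StepPath.exists_sorted {r s : α → α → Prop}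
    (hex : ∀ a b c, s a b → r b c → ∃ b', r a b' ∧ s b' c) {n : ℕ} {x z : α}
    (p : StepPath (fun a b => r a b ∨ s a b) n x z) :
    ∃ k l y, k + l = n ∧ StepPath r k x y ∧ StepPath s l y z := by
  induction p with
  | refl x => exact ⟨0, 0, x, rfl, .refl x, .refl x⟩
  | tail _ h2 ih =>
    obtain ⟨k, l, y, rfl, h3, h4⟩ := ih
    rcases h2 with h2 | h2
    · obtain ⟨w, h5, h6⟩ := h4.exchange_step hex h2
      exact ⟨k + 1, l, w, by omega, h3.tail h5, h6⟩
    · exact ⟨k, l + 1, y, by omega, h3, h4.tail h2⟩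

variable [PartialOrder α]

theorem StepPath.le {n : ℕ} {x y : α} (p : StepPath (· ⋖ ·) n x y) : x ≤ y := by
  induction p with
  | refl x => exact le_rfl
  | tail _ h2 ih => exact ih.trans h2.le

theorem StepPath.exists_chain {n : ℕ} {x y : α} (p : StepPath (· ⋖ ·) n x y) :
    ∃ c : Set α, c ⊆ Set.Icc x y ∧ IsChain (· ≤ ·) c ∧ c.encard = n + 1 ∧
      ∀ z ∈ Set.Icc x y, (∀ w ∈ c, z ≤ w ∨ w ≤ z) → z ∈ c := by
  induction p with
  | refl x => exact ⟨{x}, by simp, by simp, by simp, by simp⟩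
  | @tail n x y z p h2 ih =>
    obtain ⟨c, hc, hchain, hcard, hmax⟩ := ih
    have hyc : y ∈ c := hmax y ⟨p.le, le_rfl⟩ fun w hw => Or.inr (hc hw).2
    refine ⟨insert z c, ?_, ?_, ?_, ?_⟩
    · rintro w (rfl | hw)
      · exact ⟨p.le.trans h2.le, le_rfl⟩
      · exact ⟨(hc hw).1, (hc hw).2.trans h2.le⟩
    · exact hchain.insert fun w hw _ => Or.inr ((hc hw).2.trans h2.le)
    · rw [Set.encard_insert_of_notMem fun hz => h2.lt.not_ge (hc hz).2, hcard]
      norm_cast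
    · intro w hw hcomp
      rcases hcomp y (Set.mem_insert_of_mem _ hyc) with h | h
      · exact Set.mem_insert_of_mem _
          (hmax w ⟨hw.1, h⟩ fun v hv => hcomp v (Set.mem_insert_of_mem _ hv))
      · rcases h2.eq_or_eq h hw.2 with rfl | rfl
        · exact Set.mem_insert_of_mem _ hyc
        · exact Set.mem_insert _ _

theorem mem_of_isMaxChain_of_comparable {c : Set α} (hc : IsMaxChain (· ≤ ·) c) {z : α}
    (hz : ∀ w ∈ c, z ≤ w ∨ w ≤ z) : z ∈ c := by
  have := hc.2 (hc.1.insert fun w hw _ => hz w hw) (Set.subset_insert z c)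
  rw [this]
  exact Set.mem_insert _ _

/-- The largest member of `c` below `x` is covered by `x`, by maximality of `c`; descend from there.
A path of `n` steps has `n + 1` vertices. -/
theorem exists_stepPath_of_isMaxChain [OrderBot α] [WellFoundedLT α] [WellFoundedGT α] {c : Set α}
    (hc : IsMaxChain (· ≤ ·) c) (x : α) (hx : x ∈ c) :
    ∃ n : ℕ, StepPath (· ⋖ ·) n ⊥ x ∧ (c ∩ Set.Iic x).encard = n + 1 := by
  induction x using WellFoundedLT.induction with
  | ind x ih =>
    rcases eq_or_ne x ⊥ with rfl | hne
    · refine ⟨0, .refl _, ?_⟩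
      have : c ∩ Set.Iic ⊥ = {⊥} := by
        ext z
        simp only [Set.mem_inter_iff, Set.mem_Iic, le_bot_iff, Set.mem_singleton_iff]
        exact ⟨fun h => h.2, fun h => ⟨h ▸ hx, h⟩⟩
      rw [this]; simp
    · obtain ⟨y, ⟨⟨hyc, hyx⟩, hmax⟩⟩ := exists_maximal_of_wellFoundedGT
        (fun y => y ∈ c ∧ y < x) ⟨⊥, hc.bot_mem, bot_lt_iff_ne_bot.2 hne⟩
      have hle : ∀ z ∈ c, z < x → z ≤ y := fun z hz hzx => by
        rcases hc.1.total hz hyc with h | h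
        · exact h
        · exact hmax ⟨hz, hzx⟩ h
      have hcov : y ⋖ x := by
        refine ⟨hyx, fun z hyz hzx => ?_⟩
        refine hyz.not_ge (hle z (mem_of_isMaxChain_of_comparable hc fun w hw => ?_) hzx)
        rcases hc.1.total hw hx with h | h
        · rcases h.eq_or_lt with rfl | h
          · exact Or.inl hzx.le
          · exact Or.inr ((hle w hw h).trans hyz.le)
        · exact Or.inl (hzx.le.trans h)
      obtain ⟨n, hp, hcard⟩ := ih y hyx hyc
      refine ⟨n + 1, hp.tail hcov, ?_⟩
      have : c ∩ Set.Iic x = insert x (c ∩ Set.Iic y) := by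
        ext z
        simp only [Set.mem_inter_iff, Set.mem_Iic, Set.mem_insert_iff]
        constructor
        · rintro ⟨hz, hzx⟩
          rcases hzx.eq_or_lt with h | h
          · exact Or.inl h
          · exact Or.inr ⟨hz, hle z hz h⟩
        · rintro (rfl | ⟨hz, hzy⟩)
          · exact ⟨hx, le_rfl⟩
          · exact ⟨hz, hzy.trans hyx.le⟩
      rw [this, Set.encard_insert_of_notMem fun h => hyx.not_ge h.2, hcard]
      norm_cast

/-- Two covering steps that can be replaced by three strict steps give two maximal chains of
different lengths. -/
theorem exists_encard_ne_of_longer_chain (hfin : ∀ c : Set α, IsChain (· ≤ ·) c → c.Finite)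
    {x y z a b : α} (hxy : x ⋖ y) (hyz : y ⋖ z) (hxa : x < a) (hab : a < b) (hbz : b < z)
    (hay : a ≠ y) (hby : b ≠ y) :
    ∃ c c' : Set α, IsMaxChain (· ≤ ·) c ∧ IsMaxChain (· ≤ ·) c' ∧ c.encard ≠ c'.encard := by
  have h0 : IsChain (· ≤ ·) ({x, y, z} : Set α) := by
    refine IsChain.insert (IsChain.insert (by simp) ?_) ?_
    · rintro w rfl _
      exact Or.inl hyz.le
    · rintro w (rfl | rfl) _
      · exact Or.inl hxy.le
      · exact Or.inl (hxy.le.trans hyz.le)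
  obtain ⟨c, hc, hsub⟩ := h0.exists_maxChain
  have hxc : x ∈ c := hsub (by simp)
  have hyc : y ∈ c := hsub (by simp)
  have hzc : z ∈ c := hsub (by simp)
  have hcase : ∀ w ∈ c, w ≠ y → w ≤ x ∨ z ≤ w := by
    intro w hw hwy
    rcases hc.1.total hw hyc with h | h
    · left
      rcases hc.1.total hw hxc with h' | h'
      · exact h'
      · exact ((hxy.eq_or_eq h' h).resolve_right hwy).le
    · right
      rcases hc.1.total hw hzc with h' | h'
      · exact ((hyz.eq_or_eq h h').resolve_left hwy).ge
      · exact h'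
  have hac : a ∉ c := fun h => (hcase a h hay).elim hxa.not_ge (hab.trans hbz).not_ge
  have hbc : b ∉ c := fun h => (hcase b h hby).elim (hxa.trans hab).not_ge hbz.not_ge
  -- Trading `y` for `a` and `b` gains one member; finiteness of `c` makes this a strict increase.
  have h1 : IsChain (· ≤ ·) (insert a (insert b (c \ {y}))) := by
    refine IsChain.insert (IsChain.insert (hc.1.mono Set.sdiff_subset) ?_) ?_
    · rintro w ⟨hw, hwy⟩ _
      rcases hcase w hw hwy with h | h
      · exact Or.inr (h.trans (hxa.trans hab).le)
      · exact Or.inl (hbz.le.trans h)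
    · rintro w (rfl | ⟨hw, hwy⟩) _
      · exact Or.inl hab.le
      · rcases hcase w hw hwy with h | h
        · exact Or.inr (h.trans hxa.le)
        · exact Or.inl ((hab.trans hbz).le.trans h)
  obtain ⟨c', hc', hsub'⟩ := h1.exists_maxChain
  refine ⟨c, c', hc, hc', fun e => ?_⟩
  have hcf : c.Finite := hfin c hc.1
  have h2 := Set.encard_le_encard hsub'
  rw [Set.encard_insert_of_notMem (by
      rintro (h | h)
      · exact hab.ne h
      · exact hac h.1),
    Set.encard_insert_of_notMem (fun h => hbc h.1), Set.encard_sdiff_singleton_add_one hyc,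
    ← e] at h2
  exact ((ENat.add_one_le_iff (Set.encard_ne_top_iff.2 hcf)).1 h2).false

end Order

/-! ### Counting non-inert steps by module length -/

section Length

variable {R S : Type*} [CommRing R] [CommRing S] [Algebra R S] {U T V B : Subalgebra R S}

theorem length_eq_length_add_one_of_covBy {E : Type*} [AddCommGroup E] [Module R E]
    {A B : Submodule R E} (h : A ⋖ B) : Module.length R B = Module.length R A + 1 := by
  have hs := (covBy_iff_quot_is_simple h.le).1 h
  rw [Module.length_eq_add_of_exact (Submodule.inclusion h.le)
    (Submodule.comap B.subtype A).mkQ (Submodule.inclusion_injective h.le)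
    (Submodule.mkQ_surjective _), Module.length_eq_one_iff.2 hs]
  intro x
  rw [Submodule.mkQ_apply, Submodule.Quotient.mk_eq_zero]
  exact ⟨fun hx => ⟨⟨x, hx⟩, rfl⟩, by rintro ⟨y, rfl⟩; exact y.2⟩

theorem map_mkQ_covBy {E : Type*} [AddCommGroup E] [Module R E] {p A B : Submodule R E}
    (hp : p ≤ A) (h : A ⋖ B) : A.map p.mkQ ⋖ B.map p.mkQ := by
  have hA : (A.map p.mkQ).comap p.mkQ = A := by rw [Submodule.comap_map_mkQ, sup_eq_right.2 hp]
  have hB : (B.map p.mkQ).comap p.mkQ = B := by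
    rw [Submodule.comap_map_mkQ, sup_eq_right.2 (hp.trans h.le)]
  have hinj : ∀ C D : Submodule R (E ⧸ p), C.comap p.mkQ = D.comap p.mkQ → C = D :=
    fun C D e => Submodule.comap_injective_of_surjective p.mkQ_surjective e
  refine ⟨lt_of_le_of_ne (Submodule.map_mono h.le) fun e => h.lt.ne ?_, fun C h1 h2 => ?_⟩
  · rw [← hA, ← hB, e]
  · rcases h.eq_or_eq (c := C.comap p.mkQ) (hA ▸ Submodule.comap_mono h1.le)
      (hB ▸ Submodule.comap_mono h2.le) with e | e
    · exact h1.ne (hinj _ _ (hA.trans e.symm))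
    · exact h2.ne (hinj _ _ (e.trans hB.symm))

/-- A chain of `n` minimal non-inert extensions starting from `R` ends at a ring whose quotient
by `R` has length `n` as an `R`-module. -/
theorem StepPath.length_eq [Algebra.IsIntegral R S] {n : ℕ} {U : Subalgebra R S}
    (p : StepPath (fun U T : Subalgebra R S => U ⋖ T ∧ ¬ IsInert U T) n ⊥ U) :
    ResiduallyTrivial U ∧ Module.length R ((Subalgebra.toSubmodule U).map
      (Subalgebra.toSubmodule (⊥ : Subalgebra R S)).mkQ) = n := by
  generalize hb : (⊥ : Subalgebra R S) = W at p
  induction p with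
  | refl x =>
    subst hb
    refine ⟨residuallyTrivial_bot, ?_⟩
    rw [Submodule.mkQ_map_self]
    simp [Module.length_eq_zero]
  | @tail n x y z p h2 ih =>
    obtain ⟨h3, h4⟩ := ih hb
    subst hb
    refine ⟨h3.of_covBy h2.1 h2.2, ?_⟩
    rw [length_eq_length_add_one_of_covBy (map_mkQ_covBy
      (Subalgebra.toSubmodule.le_iff_le.2 bot_le) (h3.covBy_toSubmodule h2.1 h2.2)), h4]
    norm_cast

end Length

/-! ### Subalgebras over the t-closure -/

section Transfer

variable {R S : Type*} [CommRing R] [CommRing S] [Algebra R S] {B : Subalgebra R S}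

theorem exists_restrictScalars_eq {W : Subalgebra R S} (h : B ≤ W) :
    ∃ W' : Subalgebra B S, W'.restrictScalars R = W :=
  ⟨{ W with algebraMap_mem' := fun b => h b.2 }, rfl⟩

/-- The `R`-subalgebras containing `B` are the `B`-subalgebras of `S`, so a covering path from `B`
to the top is a maximal chain over `B`. -/
theorem IsCatenarian.stepPath_length_eq (h : IsCatenarian B S) {n m : ℕ}
    (p : StepPath (· ⋖ ·) n B ⊤) (q : StepPath (· ⋖ ·) m B ⊤) : n = m := by
  have key : ∀ {n : ℕ}, StepPath (· ⋖ ·) n B ⊤ →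
      ∃ c : Set (Subalgebra B S), IsMaxChain (· ≤ ·) c ∧ c.encard = n + 1 := by
    intro n p
    obtain ⟨c, hc, hchain, hcard, hmax⟩ := p.exists_chain
    let f : Subalgebra B S → Subalgebra R S := Subalgebra.restrictScalars R
    have hf : Function.Injective f := Subalgebra.restrictScalars_injective R
    have hBf : ∀ W, B ≤ f W := fun W b hb => W.algebraMap_mem ⟨b, hb⟩
    refine ⟨f ⁻¹' c, ⟨?_, ?_⟩, ?_⟩
    · intro W hW W' hW' hne
      exact hchain hW hW' fun e => hne (hf e)
    · intro d hd hcd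
      refine Set.Subset.antisymm hcd fun W hW => hmax (f W) ⟨hBf W, le_top⟩ fun V hV => ?_
      obtain ⟨V', rfl⟩ := exists_restrictScalars_eq (hc hV).1
      exact hd.total hW (hcd hV)
    · rw [← hcard, ← hf.encard_image, Set.image_preimage_eq_of_subset]
      intro V hV
      exact exists_restrictScalars_eq (hc hV).1
  obtain ⟨c, hc, h1⟩ := key p
  obtain ⟨d, hd, h2⟩ := key q
  have := h c d hc hd
  rw [h1, h2] at this
  have : n + 1 = m + 1 := by exact_mod_cast this
  omega

end Transfer

/-! ### Sorting maximal chains and counting their steps -/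

section Main

variable {R S : Type*} [CommRing R] [CommRing S] [Algebra R S] [Algebra.IsIntegral R S]

theorem StepPath.isTClosed {n : ℕ} {X Y : Subalgebra R S}
    (p : StepPath (fun U T : Subalgebra R S => U ⋖ T ∧ IsInert U T) n X Y)
    (hY : IsTClosed Y S) : IsTClosed X S := by
  induction p with
  | refl x => exact hY
  | tail _ h2 ih => exact ih (isTClosed_of_isInert h2.1 h2.2 hY)

theorem StepPath.le_of_isTClosed {n : ℕ} {X Y B : Subalgebra R S}
    (p : StepPath (fun U T : Subalgebra R S => U ⋖ T ∧ ¬ IsInert U T) n X Y)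
    (hB : IsTClosed B S) (hX : X ≤ B) : Y ≤ B := by
  induction p with
  | refl x => exact hX
  | tail _ h2 ih => exact le_of_not_isInert hB (ih hX) h2.1 h2.2

theorem isCatenarian_of_conductorSet_ne [WellFoundedLT (Subalgebra R S)]
    [WellFoundedGT (Subalgebra R S)] (hcat : IsCatenarian (tClosure R S) S)
    (hne : ∀ U T V : Subalgebra R S, U ⋖ T → IsInert U T → T ⋖ V → ¬ IsInert T V →
      conductorSet U T ≠ conductorSet T V) : IsCatenarian R S := by
  have key : ∀ c : Set (Subalgebra R S), IsMaxChain (· ≤ ·) c → ∃ k l : ℕ,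
      c.encard = ((k + l : ℕ) : ℕ∞) + 1 ∧ StepPath (· ⋖ ·) l (tClosure R S) ⊤ ∧
      Module.length R ((Subalgebra.toSubmodule (tClosure R S)).map
        (Subalgebra.toSubmodule (⊥ : Subalgebra R S)).mkQ) = k := by
    intro c hc
    obtain ⟨n, p, hn⟩ := exists_stepPath_of_isMaxChain hc ⊤ hc.top_mem
    rw [Set.Iic_top, Set.inter_univ] at hn
    obtain ⟨k, l, X, rfl, p1, p2⟩ := StepPath.exists_sorted
      (r := fun U T : Subalgebra R S => U ⋖ T ∧ ¬ IsInert U T)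
      (s := fun U T : Subalgebra R S => U ⋖ T ∧ IsInert U T)
      (by
        rintro U T V ⟨h, hi⟩ ⟨h', hn⟩
        obtain ⟨T', h1, h2, h3, h4⟩ := exists_exchange h hi h' hn (hne U T V h hi h' hn)
        exact ⟨T', ⟨h1, h2⟩, h3, h4⟩)
      (p.mono fun U T h => by by_cases hi : IsInert U T <;> simp [h, hi])
    have htop : IsTClosed (⊤ : Subalgebra R S) S :=
      isTClosed_iff.2 fun _ _ _ _ _ => Algebra.mem_top
    -- The turning point `X` is below the t-closure by its non-inert steps, and t-closed by the
    -- inert steps above it.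
    have hX : X = tClosure R S := le_antisymm (p1.le_of_isTClosed isTClosed_tClosure bot_le)
      ((tClosure_isLeast R S).2 (p2.isTClosed htop))
    subst hX
    exact ⟨k, l, hn, p2.mono fun _ _ h => h.1, p1.length_eq.2⟩
  intro c c' hc hc'
  obtain ⟨k, l, h1, p, h2⟩ := key c hc
  obtain ⟨k', l', h1', p', h2'⟩ := key c' hc'
  have hl := hcat.stepPath_length_eq p p'
  have hk : k = k' := by exact_mod_cast h2.symm.trans h2'
  rw [h1, h1', hl, hk]

end Main

end RingExt

theorem proposition3p6 {R S : Type*} [CommRing R] [CommRing S] [Algebra R S]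
    (hinj : Function.Injective (algebraMap R S))
    (hint : Algebra.IsIntegral R S)
    (hFCP : RingExt.HasFCP R S)
    (hcat : RingExt.IsCatenarian (RingExt.tClosure R S) S) :
    (RingExt.M₁ R S ∪ RingExt.M₂ R S =
      {N : Ideal S | N.IsMaximal ∧ N.comap (algebraMap R S) ∈
        RingExt.MSupp R (S ⧸ Subalgebra.toSubmodule (⊥ : Subalgebra R S))}) ∧
    (RingExt.IsCatenarian R S ↔
      ∀ U T V : Subalgebra R S,
        RingExt.IsMinimal U T → RingExt.IsInert U T →
        RingExt.IsMinimal T V → ¬ RingExt.IsInert T V →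
        ∀ N ∈ RingExt.M₁ R S, ∀ N' ∈ RingExt.M₂ R S,
          RingExt.conductorSet U T = (N' : Set S) ∩ (T : Set S) →
          RingExt.conductorSet T V = (N : Set S) ∩ (T : Set S) →
          N ≠ N') ∧
    (RingExt.M₁ R S ∩ RingExt.M₂ R S = ∅ → RingExt.IsCatenarian R S) := by
  have := RingExt.wellFoundedLT_of_hasFCP hFCP
  have := RingExt.wellFoundedGT_of_hasFCP hFCP
  have hiff : RingExt.IsCatenarian R S ↔
      ∀ U T V : Subalgebra R S,
        RingExt.IsMinimal U T → RingExt.IsInert U T →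
        RingExt.IsMinimal T V → ¬ RingExt.IsInert T V →
        ∀ N ∈ RingExt.M₁ R S, ∀ N' ∈ RingExt.M₂ R S,
          RingExt.conductorSet U T = (N' : Set S) ∩ (T : Set S) →
          RingExt.conductorSet T V = (N : Set S) ∩ (T : Set S) →
          N ≠ N' := by
    constructor
    · rintro h U T V hUT hi hTV hn N - N' - h1 h2 rfl
      rw [RingExt.isMinimal_iff_covBy] at hUT hTV
      obtain ⟨A, A', hUA, hAA', hAV, hAT, hAT'⟩ :=
        RingExt.exists_longer_chain hUT hi hTV hn (h1.trans h2.symm)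
      obtain ⟨c, c', hc, hc', hne⟩ := RingExt.exists_encard_ne_of_longer_chain hFCP
        hUT hTV hUA hAA' hAV hAT hAT'
      exact hne (h c c' hc hc')
    · intro h
      refine RingExt.isCatenarian_of_conductorSet_ne hcat fun U T V hUT hi hTV hn he => ?_
      -- With equal conductors, one `N` over them serves as both ideals and violates `N ≠ N'`.
      obtain ⟨N, hN, hNT⟩ := RingExt.exists_conductorSet_eq_inter hUT hi
      exact h U T V (RingExt.isMinimal_iff_covBy.2 hUT) hi (RingExt.isMinimal_iff_covBy.2 hTV) hn
        N (RingExt.mem_M₁_of_not_isInert hTV hn hN (he ▸ hNT))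
        N (RingExt.mem_M₂_of_isInert hUT hN hNT) hNT (he ▸ hNT) rfl
  refine ⟨RingExt.M₁_union_M₂, hiff, fun hempty => hiff.2 ?_⟩
  rintro U T V - - - - N hN N' hN' - - rfl
  exact (hempty ▸ ⟨hN, hN'⟩ : N ∈ (∅ : Set (Ideal S)))
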